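/- All statements are local near the origin of $\mathbb{R}^n$, $n\ge 1$, and "smooth" means $C^\infty$ near the origin. **Setting.** Consider a single-input system $$\dot\xi = F(\xi)+G(\xi)u,\qquad \xi\in\mathbb{R}^n,\ u\in\mathbb{R}, \tag{S}$$ where $F,G$ are smooth vector fields with $F(0)=0$ and $G(0)\neq 0$. A *lower triangular form* is a system $$\dot x_i=f_i(x_1,\dots,x_{i+1})\ (1\le i\le n-1),\qquad \dot x_n=f_n(x_1,\dots,x_n)+g_n(x_1,\dots,x_n)v$$ with smooth $f_i,g_n$, with $g_n(0)\ne0$, and with each $\partial f_i/\partial x_{i+1}$ ($1\le i\le n-1$) nonzero on an open set whose closure is a neighborhood of the origin. System (S) is *locally feedback equivalent* to such a form if there are a feedback $u=a(\xi)+b(\xi)v$ ($a,b$ smooth, $b(0)\neq0$) and a local smooth change of coordinates $x=T(\xi)$ with smooth inverse, $T(0)=0$, that transform (S) into it near the origin. A *proper $k$-multi-index* is $\alpha=(\alpha_1,\dots,\alpha_k)\in\mathbb{Z}_{\ge0}^k$ with $\alpha_k\ge1$. We write $\lessdot$ for the lexicographical order: $\alpha\lessdot\beta$ if for some $i$ one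 has $\alpha_i<\beta_i$ and $\alpha_j=\beta_j$ for all $j<i$. For a smooth function $p(x_1,\dots,x_m)$ and $1\le k\le m$, $\mathcal{L}_k(p)$ denotes the $\lessdot$-least proper $k$-multi-index $\alpha$ with $\frac{\partial^{\alpha}p}{\partial x^\alpha}(0)\neq0$ (if there is one). Write $\mathrm{ad}_XY=[X,Y]$ and, for a tuple $Y=(Y^1,\dots,Y^k)$ and a $k$-multi-index $\alpha$, $\mathrm{ad}_Y^\alpha F=\mathrm{ad}_{Y^1}^{\alpha_1}\cdots\mathrm{ad}_{Y^k}^{\alpha_k}F$. **Adapted data.** *Adapted data* for (S) consist of the following. * Smooth involutive distributions $D^l$, $l=1,\dots,n+1$, of dimension $n-l+1$, with $D^{n+1}=0$, $D^n=\mathrm{span}\{G\}$, for which there are smooth vector fields $G^{i+1}\in D^{i+1}\setminus D^{i+2}$ ($i=n-1,\dots,1$; that is, $G^{i+1}$ is a section of $D^{i+1}$ near the origin but not of $D^{i+2}$) such that, setting $\hat D^n=\mathrm{span}\{G\}$ and $\hat D^i=\mathrm{span}\{\mathrm{ad}_{G^{i+1}}F,\hat D^{i+1}\}$, for each $i=n-1,\dots,1$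 one has $D^i=\hat D^i$ on an open set whose closure is a neighborhood of the origin. * Smooth vector fields $X^l\in D^l$ with $X^l(0)\notin D^{l+1}(0)$, $l=1,\dots,n$. * For each $i=1,\dots,n-1$, a tuple $Y^i=(Y^{i,1},\dots,Y^{i,i+1})$ of smooth vector fields such that, for $j=1,\dots,i+1$, $Y^{i,j}\in D^j$, $Y^{i,j}(0)\notin D^{j+1}(0)$, $[X^l,Y^{i,j}]\in D^{i+1}$ for $i+1\le l\le n$, and $[X^i,Y^{i,j}]\in D^i$. **Theorem.** For each $i=1,\dots,n-1$ let $\alpha^i$ be a proper $(i+1)$-multi-index. Then (S) is locally feedback equivalent to a lower triangular form with $\mathcal{L}_{i+1}(f_i)=\alpha^i$ for all $i=1,\dots,n-1$ if and only if the following two conditions hold. (i) (S) is locally feedback equivalent to some lower triangular form. (ii) For all adapted data $(D^l),(X^l),(Y^{i})$ of (S) and for every $i=1,\dots,n-1$, one has $\mathrm{ad}_{Y^i}^{\alpha^i}F(0)\notin D^{i+1}(0)$, and $\mathrm{ad}_{Y^i}^{\alpha}F(0)\in D^{i+1}(0)$ for every proper $(i+1)$-multi-index $\alpha\lessdot\alpha^i$.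 The equivalence also holds with "for all adapted data" in (ii) replaced by "for some adapted data". -/

import Mathlib

open Filter
open scoped Topology ContDiff

noncomputable section

namespace LowerTri

/-- Points (and tangent vectors) of `ℝⁿ`. -/
abbrev Pt (n : ℕ) : Type := Fin n → ℝ

/-- Vector fields on `ℝⁿ`; all conditions on them are imposed only near the origin. -/
abbrev VF (n : ℕ) : Type := Pt n → Pt n

/-- `p` is smooth on some neighborhood of the origin. -/
def SmoothNear {n : ℕ} {V : Type*} [NormedAddCommGroup V] [NormedSpace ℝ V]
    (p : Pt n → V) : Prop :=
  ∀ᶠ x in 𝓝 (0 : Pt n), ContDiffAt ℝ ∞ p x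

/-- `P` holds on an open set whose closure is a neighborhood of the origin. -/
def DenselyNear {n : ℕ} (P : Pt n → Prop) : Prop :=
  ∃ O : Set (Pt n), IsOpen O ∧ closure O ∈ 𝓝 (0 : Pt n) ∧ ∀ x ∈ O, P x

/-! ### Multi-indices -/

/-- The composite `A₁^{α₁} A₂^{α₂} ⋯ Aₙ^{αₙ} v` (the operator with the largest index acts
first). -/
def multiIterate {n : ℕ} {V : Type*} (A : Fin n → V → V) (α : Fin n → ℕ) (v : V) : V :=
  (List.finRange n).foldr (fun j w => (A j)^[α j] w) v

/-- The partial derivative `∂p/∂x_k`. -/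
def pderiv {n : ℕ} (k : Fin n) (p : Pt n → ℝ) : Pt n → ℝ :=
  fun x => fderiv ℝ p x (Pi.single k 1)

/-- The mixed partial derivative `∂^α p / ∂x^α`. -/
def multiDeriv {n : ℕ} (α : Fin n → ℕ) (p : Pt n → ℝ) : Pt n → ℝ :=
  multiIterate pderiv α p

/-- The last nonzero entry of `α` is the one with index `k`. A multi-index with fewer than `n`
entries is padded by zeros. -/
def IsProper {n : ℕ} (k : Fin n) (α : Fin n → ℕ) : Prop :=
  1 ≤ α k ∧ ∀ j, k < j → α j = 0

/-- The lexicographical order on multi-indices. -/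
def LexLT {n : ℕ} (α β : Fin n → ℕ) : Prop :=
  ∃ i, α i < β i ∧ ∀ j, j < i → α j = β j

/-- The proper multi-indices of `p` with last nonzero entry at `k`. -/
def properIndices {n : ℕ} (k : Fin n) (p : Pt n → ℝ) : Set (Fin n → ℕ) :=
  {α | IsProper k α ∧ multiDeriv α p 0 ≠ 0}

/-- `α` is the lexicographically least element of `properIndices k p`. -/
def IsLeastIndex {n : ℕ} (k : Fin n) (p : Pt n → ℝ) (α : Fin n → ℕ) : Prop :=
  α ∈ properIndices k p ∧ ∀ β ∈ properIndices k p, β ≠ α → LexLT α β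

/-! ### Lower triangular forms and feedback equivalence

The dimension is written `m + 1`. With coordinates numbered `0, …, m`, the equations that are
not actuated are those with index `i.castSucc` for `i : Fin m`, and `i.succ` is the index of the
next coordinate. -/

/-- `ẋ = f(x) + g(x) v` is a lower triangular form near the origin. -/
structure IsLowerTriangular {m : ℕ} (f g : VF (m + 1)) : Prop where
  smooth_f : SmoothNear f
  smooth_g : SmoothNear g
  /-- the `i`-th equation involves the coordinates up to the next one only -/
  depends : ∀ i : Fin m, ∃ U ∈ 𝓝 (0 : Pt (m + 1)), ∀ x ∈ U, ∀ y ∈ U,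
    (∀ k ≤ i.succ, x k = y k) → f x i.castSucc = f y i.castSucc
  /-- the `i`-th right-hand side genuinely involves the next coordinate near the origin -/
  nondegenerate : ∀ i : Fin m,
    DenselyNear fun x => pderiv i.succ (fun z => f z i.castSucc) x ≠ 0
  g_eq_zero : ∀ᶠ x in 𝓝 (0 : Pt (m + 1)), ∀ i : Fin m, g x i.castSucc = 0
  g_last : g 0 (Fin.last m) ≠ 0

/-- `x = T(ξ)` is a local change of coordinates at the origin, fixing the origin. -/
def IsCoordChange {n : ℕ} (T : Pt n → Pt n) : Prop :=
  T 0 = 0 ∧ SmoothNear T ∧ ∃ S : Pt n → Pt n, SmoothNear S ∧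
    (∀ᶠ ξ in 𝓝 (0 : Pt n), S (T ξ) = ξ) ∧ ∀ᶠ x in 𝓝 (0 : Pt n), T (S x) = x

/-- Near the origin, the feedback `u = a(ξ) + b(ξ) v` with `b(0) ≠ 0` and the change of
coordinates `x = T(ξ)` turn `ξ' = F(ξ) + G(ξ) u` into `x' = f(x) + g(x) v`. -/
def FeedbackEquivalent {n : ℕ} (F G f g : VF n) : Prop :=
  ∃ (T : Pt n → Pt n) (a b : Pt n → ℝ),
    IsCoordChange T ∧ SmoothNear a ∧ SmoothNear b ∧ b 0 ≠ 0 ∧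
    ∀ᶠ ξ in 𝓝 (0 : Pt n),
      fderiv ℝ T ξ (F ξ + a ξ • G ξ) = f (T ξ) ∧ fderiv ℝ T ξ (b ξ • G ξ) = g (T ξ)

/-- The system is locally feedback equivalent to some lower triangular form. -/
def EquivTriangular {m : ℕ} (F G : VF (m + 1)) : Prop :=
  ∃ f g : VF (m + 1), FeedbackEquivalent F G f g ∧ IsLowerTriangular f g

/-- The system is locally feedback equivalent to a lower triangular form whose `i`-th right-hand
side has least multi-index `α i` (with respect to the coordinates up to the next one). -/
def EquivTriangularOfType {m : ℕ} (F G : VF (m + 1)) (α : Fin m → Fin (m + 1) → ℕ) : Prop :=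
  ∃ f g : VF (m + 1), FeedbackEquivalent F G f g ∧ IsLowerTriangular f g ∧
    ∀ i : Fin m, IsLeastIndex i.succ (fun x => f x i.castSucc) (α i)

/-! ### Distributions and the bracket test -/

/-- Distributions: a subspace of the tangent space at each point. -/
abbrev Distr (n : ℕ) : Type := Pt n → Submodule ℝ (Pt n)

/-- Near the origin, the vector field `X` takes its values in `D`. -/
def IsSection {n : ℕ} (X : VF n) (D : Distr n) : Prop :=
  ∀ᶠ x in 𝓝 (0 : Pt n), X x ∈ D x

/-- Near the origin, `D` is a smooth distribution of dimension `r`. -/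
def IsSmoothDistr {n : ℕ} (r : ℕ) (D : Distr n) : Prop :=
  ∃ V : Fin r → VF n, (∀ k, SmoothNear (V k)) ∧
    ∀ᶠ x in 𝓝 (0 : Pt n), LinearIndependent ℝ (fun k => V k x) ∧
      D x = Submodule.span ℝ (Set.range fun k => V k x)

/-- Near the origin, `D` is closed under the Lie bracket. -/
def IsInvolutive {n : ℕ} (D : Distr n) : Prop :=
  ∀ X Y : VF n, SmoothNear X → SmoothNear Y → IsSection X D → IsSection Y D →
    IsSection (VectorField.lieBracket ℝ X Y) D

/-- The span of `G` and of the brackets `ad_{K i} F` with `l ≤ i`. This unfolds the recursion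
`D̂ m = span {G}`, `D̂ l = span {ad_{K l} F, D̂ (l + 1)}`. -/
def hatDistr {m : ℕ} (F G : VF (m + 1)) (K : Fin m → VF (m + 1)) (l : ℕ) : Distr (m + 1) :=
  fun x => Submodule.span ℝ
    ({G x} ∪ {v | ∃ i : Fin m, l ≤ (i : ℕ) ∧ v = VectorField.lieBracket ℝ (K i) F x})

/-- `D 0, …, D (m + 1)` are the involutive distributions attached to `ξ' = F(ξ) + G(ξ) u`:
`D (m + 1) = 0`, `D m = span {G}`, and for `l = m - 1, …, 0`, given a vector field `K l` in
`D (l + 1)` but not in `D (l + 2)`, `D l` is the involutive distribution of dimension `m + 1 - l`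
that agrees with `hatDistr F G K l` on an open set whose closure is a neighborhood of the origin.
(Terms `D l` with `l > m + 1` are irrelevant.) -/
structure IsSystemFlag {m : ℕ} (F G : VF (m + 1)) (D : ℕ → Distr (m + 1)) : Prop where
  top : ∀ᶠ x in 𝓝 (0 : Pt (m + 1)), D (m + 1) x = ⊥
  input : ∀ᶠ x in 𝓝 (0 : Pt (m + 1)), D m x = Submodule.span ℝ {G x}
  smooth : ∀ l ≤ m + 1, IsSmoothDistr (m + 1 - l) (D l)
  involutive : ∀ l ≤ m + 1, IsInvolutive (D l)
  generated : ∃ K : Fin m → VF (m + 1), ∀ i : Fin m,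
    SmoothNear (K i) ∧ IsSection (K i) (D (i + 1)) ∧ ¬ IsSection (K i) (D (i + 2)) ∧
    DenselyNear fun x => D i x = hatDistr F G K i x

/-- `X 0, …, X m` are smooth vector fields with `X l ∈ D l` and `X l (0) ∉ D (l + 1) (0)`. -/
def IsFlagFrame {m : ℕ} (D : ℕ → Distr (m + 1)) (X : Fin (m + 1) → VF (m + 1)) : Prop :=
  ∀ l : Fin (m + 1), SmoothNear (X l) ∧ IsSection (X l) (D l) ∧ X l 0 ∉ D (l + 1) 0

/-- `Y i = (Y i 0, …, Y i (i + 1))`, for `i : Fin m`, are tuples of smooth vector fields adapted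
to `D` and `X`. (Entries `Y i j` with `j > i + 1` are irrelevant.) -/
def IsAdaptedTuple {m : ℕ} (D : ℕ → Distr (m + 1)) (X : Fin (m + 1) → VF (m + 1))
    (Y : Fin m → Fin (m + 1) → VF (m + 1)) : Prop :=
  ∀ i : Fin m, ∀ j ≤ i.succ,
    SmoothNear (Y i j) ∧ IsSection (Y i j) (D j) ∧ Y i j 0 ∉ D (j + 1) 0 ∧
    (∀ l : Fin (m + 1), i.succ ≤ l →
      IsSection (VectorField.lieBracket ℝ (X l) (Y i j)) (D (i + 1))) ∧
    IsSection (VectorField.lieBracket ℝ (X i.castSucc) (Y i j)) (D i)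

/-- `D`, `X`, `Y` are as required in the bracket condition for the system `(F, G)`. -/
def IsAdaptedData {m : ℕ} (F G : VF (m + 1)) (D : ℕ → Distr (m + 1))
    (X : Fin (m + 1) → VF (m + 1)) (Y : Fin m → Fin (m + 1) → VF (m + 1)) : Prop :=
  IsSystemFlag F G D ∧ IsFlagFrame D X ∧ IsAdaptedTuple D X Y

/-- The iterated bracket `ad_Y^α F = ad_{Y 0}^{α 0} ⋯ ad_{Y m}^{α m} F`. -/
def adMulti {n : ℕ} (Y : Fin n → VF n) (α : Fin n → ℕ) (F : VF n) : VF n :=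
  multiIterate (fun j W => VectorField.lieBracket ℝ (Y j) W) α F

/-- For every `i`, `ad_{Y i}^{α i} F (0) ∉ D (i + 1) (0)`, and `ad_{Y i}^β F (0) ∈ D (i + 1) (0)`
for every lexicographically smaller proper multi-index `β` (last nonzero entry at `i + 1`). -/
def BracketTest {m : ℕ} (F : VF (m + 1)) (D : ℕ → Distr (m + 1))
    (Y : Fin m → Fin (m + 1) → VF (m + 1)) (α : Fin m → Fin (m + 1) → ℕ) : Prop :=
  ∀ i : Fin m, adMulti (Y i) (α i) F 0 ∉ D (i + 1) 0 ∧
    ∀ β : Fin (m + 1) → ℕ, IsProper i.succ β → LexLT β (α i) →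
      adMulti (Y i) β F 0 ∈ D (i + 1) 0

end LowerTri

end

/-!
The theorem follows from a computation in one chart. Suppose that `x = T(ξ)`, together with a
feedback, puts the system into triangular form with right-hand sides `p_i`, `i < m`. Since the input
acts on the last equation only, `p_i ∘ T` is the `i`-th component `dx_i(F)` of the drift itself.

The flag is intrinsic. A bracket of `F` with a field of `span {∂_{l+1}, …, ∂_m}` lies in
`span {∂_l, …, ∂_m}`, by triangularity. Hence, downwards in `l`, each `D l` of a system flag is
contained in `span {∂_l, …, ∂_m}` at the points of an open set dense near the origin, by continuity
at all points near the origin, and the two agree by dimension (`IsTriangularChart.eq_coordDistr`).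
Conversely the coordinate distributions form a flag, and the coordinate fields complete it to
adapted data (`IsTriangularChart.isAdaptedData_coordField`).

The brackets differentiate the right-hand sides. The bracket conditions on `Y^{i,j}` say that its
components before the `i`-th depend on `x_0, …, x_{i-1}` only and the `i`-th on `x_0, …, x_i` only.
Therefore `ad_{Y^{i,j}}` acts on the `i`-th component of a field `W` of `D i` by
`w ↦ dw(Y^{i,j}) - c w`, where `c` is the derivative along `∂_i` of the `i`-th component of
`Y^{i,j}`. Here `Y^{i,j}` is a multiple of `∂_j`, nonzero at the origin, plus a
combination of `∂_s` with `s > j`; replacing a `∂_j` by such a `∂_s`, or dropping it, makes a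
multi-index lexicographically smaller. So the `i`-th component of `ad_{Y^i}^α F` is `∂^α p_i` times
a function not vanishing at the origin, plus a combination of the `∂^β p_i` with `β` proper and
smaller than `α` (`IsTriangularChart.adMulti_hasLeading`). By well-founded induction on the
lexicographical order, the bracket test for `α`, with any adapted data, says precisely that `α i` is
the least multi-index of `p_i` (`IsTriangularChart.bracketTest_iff`). In particular the outcome of
the test does not depend on the adapted data, and this property of `α` does not depend on the
triangular form.
-/

namespace LowerTri

variable {n : ℕ}

/-! ### Germs of smooth functions -/

section Smooth

variable {V : Type*} [NormedAddCommGroup V] [NormedSpace ℝ V]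

theorem SmoothNear.congr {p q : Pt n → V} (hp : SmoothNear p) (h : q =ᶠ[𝓝 0] p) :
    SmoothNear q := by
  filter_upwards [hp, h.eventuallyEq_nhds] with x hx h'
  exact hx.congr_of_eventuallyEq h'

theorem smoothNear_const (c : V) : SmoothNear (fun _ : Pt n => c) :=
  Eventually.of_forall fun _ => contDiffAt_const

theorem SmoothNear.add {p q : Pt n → V} (hp : SmoothNear p) (hq : SmoothNear q) :
    SmoothNear (fun x => p x + q x) := by
  filter_upwards [hp, hq] with x h1 h2 using h1.add h2

theorem SmoothNear.sub {p q : Pt n → V} (hp : SmoothNear p) (hq : SmoothNear q) :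
    SmoothNear (fun x => p x - q x) := by
  filter_upwards [hp, hq] with x h1 h2 using h1.sub h2

theorem SmoothNear.mul {p q : Pt n → ℝ} (hp : SmoothNear p) (hq : SmoothNear q) :
    SmoothNear (fun x => p x * q x) := by
  filter_upwards [hp, hq] with x h1 h2 using h1.mul h2

theorem SmoothNear.coord {ι : Type*} [Fintype ι] {p : Pt n → ι → ℝ} (hp : SmoothNear p) (s : ι) :
    SmoothNear (fun x => p x s) := by
  filter_upwards [hp] with x h using contDiffAt_pi.1 h s

theorem SmoothNear.fderiv_apply {p : Pt n → V} {W : VF n} (hp : SmoothNear p)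
    (hW : SmoothNear W) : SmoothNear (fun x => fderiv ℝ p x (W x)) := by
  filter_upwards [hp, hW] with x h1 h2
  exact (h1.fderiv_right (m := ∞) (by simp)).clm_apply h2

theorem SmoothNear.differentiableAt {p : Pt n → V} (hp : SmoothNear p) :
    ∀ᶠ x in 𝓝 (0 : Pt n), DifferentiableAt ℝ p x := by
  filter_upwards [hp] with x h using h.differentiableAt (by simp)

theorem SmoothNear.continuousAt {p : Pt n → V} (hp : SmoothNear p) : ContinuousAt p 0 :=
  hp.self_of_nhds.continuousAt

theorem SmoothNear.comp {p : Pt n → V} {T : Pt n → Pt n} (hp : SmoothNear p)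
    (hT : SmoothNear T) (hT0 : T 0 = 0) : SmoothNear (fun x => p (T x)) := by
  have h : Tendsto T (𝓝 0) (𝓝 0) := by
    have := hT.continuousAt.tendsto
    rwa [hT0] at this
  filter_upwards [h.eventually hp, hT] with x h1 h2
  exact h1.comp x h2

theorem SmoothNear.lieBracket {X Y : VF n} (hX : SmoothNear X) (hY : SmoothNear Y) :
    SmoothNear (VectorField.lieBracket ℝ X Y) :=
  (hY.fderiv_apply hX).sub (hX.fderiv_apply hY)

theorem SmoothNear.pderiv {p : Pt n → ℝ} (hp : SmoothNear p) (k : Fin n) :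
    SmoothNear (pderiv k p) :=
  hp.fderiv_apply (smoothNear_const _)

theorem pderiv_congr {p q : Pt n → ℝ} (h : p =ᶠ[𝓝 0] q) (k : Fin n) :
    pderiv k p =ᶠ[𝓝 0] pderiv k q := by
  filter_upwards [Filter.EventuallyEq.fderiv (𝕜 := ℝ) h] with x hx
  simp only [LowerTri.pderiv, hx]

theorem pderiv_comm {p : Pt n → ℝ} (hp : SmoothNear p) (k l : Fin n) :
    pderiv k (pderiv l p) =ᶠ[𝓝 0] pderiv l (pderiv k p) := by
  filter_upwards [hp] with x h
  have hd : DifferentiableAt ℝ (fderiv ℝ p) x :=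
    (h.fderiv_right (m := ∞) (by simp)).differentiableAt (by simp)
  have key : ∀ k l : Fin n, LowerTri.pderiv k (LowerTri.pderiv l p) x =
      fderiv ℝ (fderiv ℝ p) x (Pi.single k 1) (Pi.single l 1) := by
    intro k l
    have := (hd.hasFDerivAt.clm_apply (hasFDerivAt_const (Pi.single l (1 : ℝ)) x)).fderiv
    change fderiv ℝ (fun y => fderiv ℝ p y (Pi.single l 1)) x _ = _
    simp [this]
  rw [key, key]
  exact (h.isSymmSndFDerivAt
    (by rw [minSmoothness_of_isRCLikeNormedField]; exact WithTop.coe_le_coe.2 le_top)).eq _ _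

end Smooth

/-! ### Multi-indices -/

theorem foldr_iterate_eq_self {V : Type*} (A : Fin n → V → V) (γ : Fin n → ℕ) (v : V) :
    ∀ l : List (Fin n), (∀ s ∈ l, γ s = 0) → l.foldr (fun j w => (A j)^[γ j] w) v = v
  | [], _ => rfl
  | a :: l, h => by
    rw [List.foldr_cons, foldr_iterate_eq_self A γ v l fun s hs => h s (List.mem_cons_of_mem _ hs),
      h a List.mem_cons_self, Function.iterate_zero_apply]

theorem foldr_iterate_add_single {V : Type*} (A : Fin n → V → V) {γ : Fin n → ℕ} {j : Fin n}
    (hγ : ∀ s < j, γ s = 0) (v : V) :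
    ∀ l : List (Fin n), l.Pairwise (· < ·) → j ∈ l →
      l.foldr (fun i w => (A i)^[(γ + Pi.single j 1 : Fin n → ℕ) i] w) v =
        A j (l.foldr (fun i w => (A i)^[γ i] w) v)
  | [], _, hj => by simp at hj
  | a :: l, hl, hj => by
    rw [List.pairwise_cons] at hl
    rw [List.foldr_cons, List.foldr_cons]
    rcases eq_or_ne j a with rfl | hja
    · have : l.foldr (fun i w => (A i)^[(γ + Pi.single j 1 : Fin n → ℕ) i] w) v =
          l.foldr (fun i w => (A i)^[γ i] w) v := by
        refine List.foldr_ext _ _ _ fun i hi w => ?_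
        simp [Pi.single_eq_of_ne (hl.1 i hi).ne']
      rw [this, Pi.add_apply, Pi.single_eq_same, Function.iterate_succ_apply']
    · have hjl : j ∈ l := by simpa [hja] using hj
      rw [foldr_iterate_add_single A hγ v l hl.2 hjl]
      simp [Pi.single_eq_of_ne hja.symm, hγ a (hl.1 j hjl)]

/-- The composite of operators is built up by adding the smallest index last. -/
theorem multiIterate_add_single {V : Type*} (A : Fin n → V → V) {γ : Fin n → ℕ} {j : Fin n}
    (hγ : ∀ s < j, γ s = 0) (v : V) :
    multiIterate A (γ + Pi.single j 1) v = A j (multiIterate A γ v) :=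
  foldr_iterate_add_single A hγ v _ (List.pairwise_lt_finRange n) (List.mem_finRange j)

theorem multiIterate_zero {V : Type*} (A : Fin n → V → V) (v : V) : multiIterate A 0 v = v :=
  foldr_iterate_eq_self A 0 v _ fun _ _ => rfl

theorem multiIterate_single {V : Type*} (A : Fin n → V → V) (j : Fin n) (v : V) :
    multiIterate A (Pi.single j 1) v = A j v := by
  have := multiIterate_add_single A (γ := 0) (j := j) (fun _ _ => rfl) v
  rwa [zero_add, multiIterate_zero] at this

/-- Every multi-index is obtained from `0` by raising entries in decreasing order of position. -/
theorem multiIndex_induction {P : (Fin n → ℕ) → Prop} (h0 : P 0)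
    (hs : ∀ γ j, (∀ s < j, γ s = 0) → P γ → P (γ + Pi.single j 1)) (α : Fin n → ℕ) : P α := by
  induction hN : ∑ i, α i using Nat.strong_induction_on generalizing α with
  | _ N ih =>
    by_cases hα : α = 0
    · exact hα ▸ h0
    obtain ⟨j, hj, hmin⟩ : ∃ j, α j ≠ 0 ∧ ∀ s < j, α s = 0 := by
      have hne : (Finset.univ.filter fun s => α s ≠ 0).Nonempty := by
        obtain ⟨s, hs⟩ := Function.ne_iff.1 hα
        exact ⟨s, by simpa using hs⟩
      refine ⟨_, (Finset.mem_filter.1 (Finset.min'_mem _ hne)).2, fun s hs => ?_⟩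
      by_contra h
      exact absurd (Finset.min'_le _ s (by simpa using h)) (not_le.2 hs)
    have hsum : α - Pi.single j 1 + Pi.single j 1 = α := by
      refine tsub_add_cancel_of_le fun s => ?_
      rcases eq_or_ne s j with rfl | h
      · simpa using Nat.one_le_iff_ne_zero.2 hj
      · simp [h]
    rw [← hsum]
    refine hs _ _ (fun s hsj => by simp [hmin s hsj]) (ih _ ?_ _ rfl)
    rw [← hN]
    refine Finset.sum_lt_sum (fun s _ => by simp) ⟨j, Finset.mem_univ _, ?_⟩
    simp only [Pi.sub_apply, Pi.single_eq_same]
    omega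

/-- The induction of `multiIndex_induction` for proper multi-indices: it starts at the first unit
in position `k`. -/
theorem IsProper.induction {k : Fin n} {P : (Fin n → ℕ) → Prop} (h0 : P (Pi.single k 1))
    (hs : ∀ γ j, IsProper k γ → j ≤ k → (∀ s < j, γ s = 0) → P γ → P (γ + Pi.single j 1))
    {α : Fin n → ℕ} (hα : IsProper k α) : P α := by
  revert hα
  refine multiIndex_induction (P := fun α => IsProper k α → P α) (fun h => ?_) ?_ α
  · simpa using h.1
  intro γ j hj ih hα
  have hjk : j ≤ k := by
    by_contra h
    have := hα.2 j (not_le.1 h)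
    simp at this
  by_cases hγ : 1 ≤ γ k
  · have hp : IsProper k γ := ⟨hγ, fun s hs => by have := hα.2 s hs; simp at this; exact this.1⟩
    exact hs γ j hp hjk hj (ih hp)
  · have hjk' : j = k := by
      by_contra h
      have := hα.1
      simp [Ne.symm h] at this
      omega
    subst hjk'
    have : γ = 0 := by
      funext s
      rcases lt_trichotomy s j with h | rfl | h
      · exact hj s h
      · simpa using hγ
      · have := hα.2 s h; simp at this; exact this.1
    rw [this, zero_add]
    exact h0

theorem IsProper.add_single {k j : Fin n} {γ : Fin n → ℕ} (hγ : IsProper k γ) (hj : j ≤ k) :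
    IsProper k (γ + Pi.single j 1) := by
  refine ⟨by have := hγ.1; simp only [Pi.add_apply]; omega, fun s hs => ?_⟩
  simp [hγ.2 s hs, (hj.trans_lt hs).ne']

theorem lexLT_iff {α β : Fin n → ℕ} : LexLT α β ↔ toLex α < toLex β :=
  ⟨fun ⟨i, h, h'⟩ => ⟨i, h', h⟩, fun ⟨i, h', h⟩ => ⟨i, h, h'⟩⟩

theorem LexLT.trans {α β γ : Fin n → ℕ} (h : LexLT α β) (h' : LexLT β γ) : LexLT α γ :=
  lexLT_iff.2 ((lexLT_iff.1 h).trans (lexLT_iff.1 h'))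

theorem lexLT_wellFounded : WellFounded (LexLT (n := n)) :=
  Subrelation.wf (fun h => lexLT_iff.1 h)
    (InvImage.wf toLex (wellFounded_lt (α := Lex (Fin n → ℕ))))

theorem LexLT.add_right {α β : Fin n → ℕ} (h : LexLT α β) (δ : Fin n → ℕ) :
    LexLT (α + δ) (β + δ) := by
  obtain ⟨i, h, h'⟩ := h
  exact ⟨i, by simpa using h, fun j hj => by simp [h' j hj]⟩

theorem lexLT_add_single (γ : Fin n → ℕ) (j : Fin n) : LexLT γ (γ + Pi.single j 1) :=
  ⟨j, by simp, fun s hs => by simp [hs.ne]⟩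

theorem lexLT_add_single_of_lt (γ : Fin n → ℕ) {j s : Fin n} (h : j < s) :
    LexLT (γ + Pi.single s 1) (γ + Pi.single j 1) :=
  ⟨j, by simp [h.ne], fun t ht => by simp [ht.ne, (ht.trans h).ne]⟩

/-! ### Mixed partial derivatives -/

theorem SmoothNear.multiDeriv {p : Pt n → ℝ} (hp : SmoothNear p) (α : Fin n → ℕ) :
    SmoothNear (multiDeriv α p) := by
  refine multiIndex_induction (P := fun α => SmoothNear (LowerTri.multiDeriv α p)) ?_ ?_ α
  · rwa [LowerTri.multiDeriv, multiIterate_zero]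
  · intro γ j hj ih
    rw [LowerTri.multiDeriv, multiIterate_add_single _ hj]
    exact ih.pderiv j

theorem multiDeriv_congr {p q : Pt n → ℝ} (h : p =ᶠ[𝓝 0] q) (α : Fin n → ℕ) :
    multiDeriv α p =ᶠ[𝓝 0] multiDeriv α q := by
  refine multiIndex_induction (P := fun α => multiDeriv α p =ᶠ[𝓝 0] multiDeriv α q) ?_ ?_ α
  · simpa only [multiDeriv, multiIterate_zero]
  · intro γ j hj ih
    rw [multiDeriv, multiDeriv, multiIterate_add_single _ hj, multiIterate_add_single _ hj]
    exact pderiv_congr ih j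

theorem pderiv_multiDeriv_comm {p : Pt n → ℝ} (hp : SmoothNear p) (s : Fin n) (α : Fin n → ℕ) :
    pderiv s (multiDeriv α p) =ᶠ[𝓝 0] multiDeriv α (pderiv s p) := by
  refine multiIndex_induction
    (P := fun α => pderiv s (multiDeriv α p) =ᶠ[𝓝 0] multiDeriv α (pderiv s p)) ?_ ?_ α
  · simp only [multiDeriv, multiIterate_zero]; rfl
  · intro γ j hj ih
    rw [multiDeriv, multiDeriv, multiIterate_add_single _ hj, multiIterate_add_single _ hj]
    exact (pderiv_comm (hp.multiDeriv γ) s j).trans (pderiv_congr ih j)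

theorem pderiv_multiDeriv {p : Pt n → ℝ} (hp : SmoothNear p) (s : Fin n) (α : Fin n → ℕ) :
    pderiv s (multiDeriv α p) =ᶠ[𝓝 0] multiDeriv (α + Pi.single s 1) p := by
  refine multiIndex_induction (P := fun α =>
    pderiv s (multiDeriv α p) =ᶠ[𝓝 0] multiDeriv (α + Pi.single s 1) p) ?_ ?_ α
  · simp only [multiDeriv, multiIterate_zero, zero_add, multiIterate_single]; rfl
  · intro γ j hj ih
    rcases lt_or_ge j s with h | h
    · have hj' : ∀ t < j, (γ + Pi.single s 1 : Fin n → ℕ) t = 0 := fun t ht => by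
        simp [hj t ht, (ht.trans h).ne]
      rw [add_right_comm, multiDeriv, multiDeriv, multiIterate_add_single _ hj,
        multiIterate_add_single _ hj']
      exact (pderiv_comm (hp.multiDeriv γ) s j).trans (pderiv_congr ih j)
    · have hj' : ∀ t < s, (γ + Pi.single j 1 : Fin n → ℕ) t = 0 := fun t ht => by
        simp [hj t (ht.trans_le h), (ht.trans_le h).ne]
      rw [multiDeriv, multiDeriv, multiIterate_add_single _ hj']

/-- A function that does not depend on `x_s` has no mixed derivatives involving `x_s`. -/
theorem multiDeriv_eq_zero {p : Pt n → ℝ} (hp : SmoothNear p) {s : Fin n}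
    (hs : pderiv s p =ᶠ[𝓝 0] 0) (α : Fin n → ℕ) :
    multiDeriv (α + Pi.single s 1) p =ᶠ[𝓝 0] 0 := by
  refine (pderiv_multiDeriv hp s α).symm.trans ((pderiv_multiDeriv_comm hp s α).trans
    ((multiDeriv_congr hs α).trans ?_))
  refine multiIndex_induction (P := fun α => multiDeriv α (0 : Pt n → ℝ) =ᶠ[𝓝 0] 0) ?_ ?_ α
  · rw [multiDeriv, multiIterate_zero]
  · intro γ j hj ih
    rw [multiDeriv, multiIterate_add_single _ hj]
    refine (pderiv_congr ih j).trans (Eventually.of_forall fun x => ?_)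
    simp [pderiv]

/-! ### Charts and components of vector fields -/

/-- `x = T(ξ)` is a change of coordinates near the origin with local inverse `S`. -/
structure IsChart (T S : Pt n → Pt n) : Prop where
  map_zero : T 0 = 0
  smooth : SmoothNear T
  smooth_inv : SmoothNear S
  left_inv : ∀ᶠ ξ in 𝓝 (0 : Pt n), S (T ξ) = ξ
  right_inv : ∀ᶠ x in 𝓝 (0 : Pt n), T (S x) = x

/-- The component along `∂/∂x_s` of the vector field `W`, in the coordinates `x = T(ξ)` but as a
function of `ξ`. -/
noncomputable def comp (T : Pt n → Pt n) (s : Fin n) (W : VF n) : Pt n → ℝ :=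
  fun ξ => fderiv ℝ T ξ (W ξ) s

/-- The distribution spanned by `∂/∂x_l, ∂/∂x_{l+1}, …` in the coordinates `x = T(ξ)`, described
as the common kernel of `dx_s` for `s < l`. -/
noncomputable def coordDistr (T : Pt n → Pt n) (l : ℕ) : Distr n :=
  fun ξ =>
    { carrier := {v | ∀ s : Fin n, (s : ℕ) < l → fderiv ℝ T ξ v s = 0}
      add_mem' := fun ha hb s hs => by simp [ha s hs, hb s hs]
      zero_mem' := fun s _ => by simp
      smul_mem' := fun c v hv s hs => by simp [hv s hs] }

/-- The vector field `∂/∂x_l` of the coordinates `x = T(ξ)`, as a function of `ξ`; here `S` is the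
inverse of `T`. -/
noncomputable def coordField (T S : Pt n → Pt n) (l : Fin n) : VF n :=
  fun ξ => fderiv ℝ S (T ξ) (Pi.single l 1)

theorem mem_coordDistr {T : Pt n → Pt n} {l : ℕ} {ξ v : Pt n} :
    v ∈ coordDistr T l ξ ↔ ∀ s : Fin n, (s : ℕ) < l → fderiv ℝ T ξ v s = 0 :=
  Iff.rfl

theorem coordDistr_anti (T : Pt n → Pt n) (ξ : Pt n) {k l : ℕ} (h : k ≤ l) :
    coordDistr T l ξ ≤ coordDistr T k ξ :=
  fun _ hv s hs => hv s (hs.trans_le h)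

theorem isSection_coordDistr {T : Pt n → Pt n} {l : ℕ} {W : VF n} :
    IsSection W (coordDistr T l) ↔ ∀ s : Fin n, (s : ℕ) < l → comp T s W =ᶠ[𝓝 0] 0 := by
  simp only [IsSection, mem_coordDistr, eventually_all]
  rfl

theorem SmoothNear.comp_field {T : Pt n → Pt n} {W : VF n} (hT : SmoothNear T)
    (hW : SmoothNear W) (s : Fin n) : SmoothNear (LowerTri.comp T s W) :=
  (hT.fderiv_apply hW).coord s

/-- Components turn the Lie bracket into the commutator of derivations. -/
theorem comp_lieBracket {T : Pt n → Pt n} {X Y : VF n} (hT : SmoothNear T) (hX : SmoothNear X)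
    (hY : SmoothNear Y) (s : Fin n) :
    comp T s (VectorField.lieBracket ℝ X Y) =ᶠ[𝓝 0]
      fun ξ => fderiv ℝ (comp T s Y) ξ (X ξ) - fderiv ℝ (comp T s X) ξ (Y ξ) := by
  filter_upwards [hT, hX, hY] with ξ h1 h2 h3
  have hd : DifferentiableAt ℝ (fderiv ℝ T) ξ :=
    (h1.fderiv_right (m := ∞) (by simp)).differentiableAt (by simp)
  have key : ∀ W : VF n, ContDiffAt ℝ ∞ W ξ → ∀ v, fderiv ℝ (comp T s W) ξ v =
      fderiv ℝ (fderiv ℝ T) ξ v (W ξ) s + fderiv ℝ T ξ (fderiv ℝ W ξ v) s := by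
    intro W hW v
    have h := hasFDerivAt_pi'.1
      (hd.hasFDerivAt.clm_apply (hW.differentiableAt (by simp)).hasFDerivAt) s
    change fderiv ℝ (fun ξ => fderiv ℝ T ξ (W ξ) s) ξ v = _
    rw [h.fderiv]
    simp [add_comm]
  have hsymm := (h1.isSymmSndFDerivAt
    (by rw [minSmoothness_of_isRCLikeNormedField]; exact WithTop.coe_le_coe.2 le_top)).eq
      (X ξ) (Y ξ)
  rw [key Y h3, key X h2, hsymm]
  simp [comp, VectorField.lieBracket]

theorem fderiv_const_germ {V : Type*} [NormedAddCommGroup V] [NormedSpace ℝ V] {p : Pt n → V}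
    {c : V} (h : p =ᶠ[𝓝 0] fun _ => c) : fderiv ℝ p =ᶠ[𝓝 0] 0 := by
  filter_upwards [Filter.EventuallyEq.fderiv (𝕜 := ℝ) h] with x hx
  rw [hx]
  simp

/-- A sequence of vectors in echelon form with respect to an injective linear map spans all vectors
whose first `l` components vanish. -/
theorem mem_span_of_echelon {V : Type*} [AddCommGroup V] [Module ℝ V] {L : V →ₗ[ℝ] Fin n → ℝ}
    (hL : Function.Injective L) {w : Fin n → V} (h0 : ∀ l s, s < l → L (w l) s = 0)
    (h1 : ∀ l, L (w l) l ≠ 0) {l : ℕ} {v : V} (hv : ∀ s : Fin n, (s : ℕ) < l → L v s = 0) :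
    v ∈ Submodule.span ℝ {x | ∃ i : Fin n, l ≤ (i : ℕ) ∧ x = w i} := by
  by_cases hl : l < n
  · set i : Fin n := ⟨l, hl⟩
    set c : ℝ := L v i / L (w i) i
    have hrec : v - c • w i ∈ Submodule.span ℝ {x | ∃ i : Fin n, l + 1 ≤ (i : ℕ) ∧ x = w i} := by
      refine mem_span_of_echelon hL h0 h1 fun s hs => ?_
      rcases Nat.lt_succ_iff_lt_or_eq.1 hs with h | h
      · simp [hv s h, h0 i s h]
      · have : s = i := Fin.ext h
        rw [this]
        simp [c, h1 i]
    rw [← sub_add_cancel v (c • w i)]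
    refine Submodule.add_mem _ (Submodule.span_mono ?_ hrec)
      (Submodule.smul_mem _ _ (Submodule.subset_span ⟨i, le_rfl, rfl⟩))
    rintro x ⟨j, hj, rfl⟩
    exact ⟨j, by omega, rfl⟩
  · have : v = 0 := hL (by
      rw [_root_.map_zero]
      funext s
      exact hv s (by omega))
    rw [this]
    exact Submodule.zero_mem _
termination_by n - l

namespace IsChart

variable {T S : Pt n → Pt n} (hT : IsChart T S)
include hT

theorem tendsto : Tendsto T (𝓝 0) (𝓝 0) := by
  have := hT.smooth.continuousAt.tendsto
  rwa [hT.map_zero] at this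

theorem inv_zero : S 0 = 0 := by
  have := hT.left_inv.self_of_nhds
  rwa [hT.map_zero] at this

theorem tendsto_inv : Tendsto S (𝓝 0) (𝓝 0) := by
  have := hT.smooth_inv.continuousAt.tendsto
  rwa [hT.inv_zero] at this

theorem fderiv_inv_fderiv :
    ∀ᶠ ξ in 𝓝 (0 : Pt n), ∀ v, fderiv ℝ S (T ξ) (fderiv ℝ T ξ v) = v := by
  filter_upwards [hT.left_inv.eventually_nhds, hT.smooth.differentiableAt,
    hT.tendsto.eventually hT.smooth_inv.differentiableAt] with ξ h h1 h2 v
  have h3 : S ∘ T =ᶠ[𝓝 ξ] id := h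
  have := h3.fderiv_eq (𝕜 := ℝ)
  rw [fderiv_comp ξ h2 h1, fderiv_id] at this
  exact congrArg (fun A : Pt n →L[ℝ] Pt n => A v) this

theorem fderiv_fderiv_inv :
    ∀ᶠ ξ in 𝓝 (0 : Pt n), ∀ v, fderiv ℝ T ξ (fderiv ℝ S (T ξ) v) = v := by
  filter_upwards [hT.fderiv_inv_fderiv] with ξ h v
  have hinj : Function.Injective (fderiv ℝ T ξ : Pt n →ₗ[ℝ] Pt n) :=
    Function.LeftInverse.injective (g := fderiv ℝ S (T ξ)) h
  obtain ⟨w, rfl⟩ := (LinearMap.injective_iff_surjective.1 hinj) v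
  exact congrArg _ (h w)

theorem fderiv_injective : ∀ᶠ ξ in 𝓝 (0 : Pt n), Function.Injective (fderiv ℝ T ξ) := by
  filter_upwards [hT.fderiv_inv_fderiv] with ξ h
  exact Function.LeftInverse.injective (g := fderiv ℝ S (T ξ)) h

theorem smooth_coordField (l : Fin n) : SmoothNear (coordField T S l) := by
  have h := hT.smooth_inv.fderiv_apply (smoothNear_const (Pi.single l (1 : ℝ)))
  exact h.comp hT.smooth hT.map_zero

theorem fderiv_coordField :
    ∀ᶠ ξ in 𝓝 (0 : Pt n), ∀ l, fderiv ℝ T ξ (coordField T S l ξ) = Pi.single l 1 := by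
  filter_upwards [hT.fderiv_fderiv_inv] with ξ h l using h _

theorem comp_coordField (l s : Fin n) :
    comp T s (coordField T S l) =ᶠ[𝓝 0] fun _ => (Pi.single l 1 : Pt n) s := by
  filter_upwards [hT.fderiv_coordField] with ξ h
  simp only [comp, h]

theorem isSection_coordField (l : Fin n) : IsSection (coordField T S l) (coordDistr T l) :=
  isSection_coordDistr.2 fun s hs => (hT.comp_coordField l s).trans
    (Eventually.of_forall fun _ => by simp [(show s < l from hs).ne])

theorem lieBracket_coordField (k l : Fin n) (r : ℕ) :
    IsSection (VectorField.lieBracket ℝ (coordField T S k) (coordField T S l))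
      (coordDistr T r) := by
  refine isSection_coordDistr.2 fun s _ => ?_
  filter_upwards [comp_lieBracket hT.smooth (hT.smooth_coordField k) (hT.smooth_coordField l) s,
    fderiv_const_germ (hT.comp_coordField k s), fderiv_const_germ (hT.comp_coordField l s)]
    with ξ h h1 h2
  simp [h, h1, h2]

theorem linearIndependent_coordField :
    ∀ᶠ ξ in 𝓝 (0 : Pt n), LinearIndependent ℝ fun l => coordField T S l ξ := by
  filter_upwards [hT.fderiv_coordField] with ξ h
  refine LinearIndependent.of_comp (fderiv ℝ T ξ : Pt n →ₗ[ℝ] Pt n) ?_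
  have : (fderiv ℝ T ξ : Pt n →ₗ[ℝ] Pt n) ∘ (fun l => coordField T S l ξ) =
      Pi.basisFun ℝ (Fin n) := by
    funext l
    simp [h]
  rw [this]
  exact (Pi.basisFun ℝ (Fin n)).linearIndependent

theorem isSmoothDistr_coordDistr (l : ℕ) : IsSmoothDistr (n - l) (coordDistr T l) := by
  let e : Fin (n - l) → Fin n := fun k => ⟨l + k, by omega⟩
  refine ⟨fun k => coordField T S (e k), fun k => hT.smooth_coordField _, ?_⟩
  filter_upwards [hT.linearIndependent_coordField, hT.fderiv_coordField, hT.fderiv_injective]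
    with ξ h1 h2 h3
  refine ⟨h1.comp e fun a b hab => ?_, le_antisymm (fun v hv => ?_) ?_⟩
  · have := congrArg Fin.val hab
    simp only [e] at this
    omega
  · refine Submodule.span_mono ?_ (mem_span_of_echelon (L := (fderiv ℝ T ξ : Pt n →ₗ[ℝ] Pt n))
      (w := fun l => coordField T S l ξ) h3 ?_ ?_ hv)
    · rintro _ ⟨i, hi, rfl⟩
      exact ⟨⟨i - l, by omega⟩, by simp only [e]; congr 1; ext; simp; omega⟩
    · intro l s hs
      simp [h2, hs.ne]
    · intro l
      simp [h2]
  · rw [Submodule.span_le]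
    rintro _ ⟨k, rfl⟩ s hs
    have : s ≠ e k := fun h => by simp [h, e] at hs
    simp [h2, this]

theorem finrank_coordDistr (l : ℕ) :
    ∀ᶠ ξ in 𝓝 (0 : Pt n), Module.finrank ℝ (coordDistr T l ξ) = n - l := by
  obtain ⟨V, -, h⟩ := hT.isSmoothDistr_coordDistr l
  filter_upwards [h] with ξ ⟨h1, h2⟩
  rw [h2, finrank_span_eq_card h1, Fintype.card_fin]

theorem isInvolutive_coordDistr (l : ℕ) : IsInvolutive (coordDistr T l) := by
  intro X Y hX hY hXD hYD
  rw [isSection_coordDistr] at *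
  intro s hs
  filter_upwards [comp_lieBracket hT.smooth hX hY s, fderiv_const_germ (hXD s hs),
    fderiv_const_germ (hYD s hs)] with ξ h h1 h2
  simp [h, h1, h2]

/-- The differential of `p ∘ T` in terms of the partial derivatives of `p`. -/
theorem fderiv_comp_eq_sum {p : Pt n → ℝ} (hp : SmoothNear p) :
    ∀ᶠ ξ in 𝓝 (0 : Pt n), ∀ v, fderiv ℝ (fun ξ => p (T ξ)) ξ v =
      ∑ s, fderiv ℝ T ξ v s * pderiv s p (T ξ) := by
  filter_upwards [hT.smooth.differentiableAt, hT.tendsto.eventually hp.differentiableAt]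
    with ξ h1 h2 v
  have := fderiv_comp ξ h2 h1
  rw [Function.comp_def] at this
  rw [this, ContinuousLinearMap.comp_apply]
  conv_lhs => rw [pi_eq_sum_univ' (fderiv ℝ T ξ v), map_sum]
  refine Finset.sum_congr rfl fun s _ => ?_
  rw [map_smul, smul_eq_mul, pderiv]

end IsChart

/-! ### Open sets dense near the origin -/

theorem denselyNear_iff {P : Pt n → Prop} :
    DenselyNear P ↔ ∀ᶠ x in 𝓝 (0 : Pt n), ∃ᶠ y in 𝓝 x, ∀ᶠ z in 𝓝 y, P z := by
  constructor
  · rintro ⟨O, hO, hc, hP⟩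
    filter_upwards [hc] with x hx
    exact (mem_closure_iff_frequently.1 hx).mono fun y hy =>
      Filter.mem_of_superset (hO.mem_nhds hy) hP
  · intro h
    refine ⟨{y | ∀ᶠ z in 𝓝 y, P z}, isOpen_setOfPred_eventually_nhds, ?_,
      fun x hx => hx.self_of_nhds⟩
    filter_upwards [h] with x hx using mem_closure_iff_frequently.2 hx

theorem DenselyNear.frequently {P : Pt n → Prop} (h : DenselyNear P) :
    ∀ᶠ x in 𝓝 (0 : Pt n), ∃ᶠ y in 𝓝 x, P y :=
  (denselyNear_iff.1 h).mono fun _ hx => hx.mono fun _ hy => hy.self_of_nhds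

theorem DenselyNear.mono {P Q : Pt n → Prop} (hP : DenselyNear P) (h : ∀ x, P x → Q x) :
    DenselyNear Q :=
  let ⟨O, hO, hc, hx⟩ := hP
  ⟨O, hO, hc, fun x hxO => h x (hx x hxO)⟩

theorem DenselyNear.and {P Q : Pt n → Prop} (hP : DenselyNear P) (hQ : DenselyNear Q) :
    DenselyNear fun x => P x ∧ Q x := by
  rw [denselyNear_iff] at *
  filter_upwards [hP, hQ.eventually_nhds] with x h1 h2
  refine frequently_frequently_nhds.1 ((h1.and_eventually h2).mono fun y hy => ?_)
  exact (hy.2.and_eventually hy.1.eventually_nhds).mono fun z hz => hz.2.and hz.1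

theorem denselyNear_of_eventually {P : Pt n → Prop} (h : ∀ᶠ x in 𝓝 (0 : Pt n), P x) :
    DenselyNear P :=
  denselyNear_iff.2 (h.eventually_nhds.eventually_nhds.mono fun _ hx => hx.frequently)

theorem denselyNear_all {ι : Type*} [Finite ι] {P : ι → Pt n → Prop}
    (h : ∀ i, DenselyNear (P i)) : DenselyNear fun x => ∀ i, P i x := by
  have := Fintype.ofFinite ι
  have key : ∀ s : Finset ι, DenselyNear fun x => ∀ i ∈ s, P i x := by
    classical
    intro s
    induction s using Finset.induction_on with
    | empty => exact denselyNear_of_eventually (by simp)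
    | insert a s _ ih =>
      simp only [Finset.forall_mem_insert]
      exact (h a).and ih
  simpa using key Finset.univ

theorem IsChart.denselyNear_comp {T S : Pt n → Pt n} (hT : IsChart T S) {P : Pt n → Prop}
    (hP : DenselyNear P) : DenselyNear fun ξ => P (T ξ) := by
  rw [denselyNear_iff] at *
  filter_upwards [hT.tendsto.eventually hP, hT.left_inv,
    hT.tendsto.eventually hT.right_inv.eventually_nhds,
    hT.tendsto.eventually hT.smooth_inv,
    hT.tendsto.eventually (hT.tendsto_inv.eventually hT.smooth.eventually_nhds)]
    with ξ h1 h2 h3 h4 h5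
  have hS : Tendsto S (𝓝 (T ξ)) (𝓝 ξ) := by
    have := h4.continuousAt.tendsto
    rwa [h2] at this
  rw [h2] at h5
  refine hS.frequently ((h1.and_eventually (h3.and (hS.eventually h5))).mono fun x hx => ?_)
  obtain ⟨hx1, hx2, hx3⟩ := hx
  have hTx := hx3.continuousAt.tendsto
  rw [hx2] at hTx
  exact hTx.eventually hx1

/-! ### Combinations of lexicographically smaller derivatives -/

/-- The mixed partial derivative `∂^β p` in the coordinates `x = T(ξ)`, as a function of `ξ`. -/
noncomputable def pullDeriv (T : Pt n → Pt n) (p : Pt n → ℝ) (β : Fin n → ℕ) : Pt n → ℝ :=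
  fun ξ => multiDeriv β p (T ξ)

/-- `LowerCombo M k γ w`: near the origin, `w` is a combination, with smooth coefficients, of
functions `M β` for proper `β` (last nonzero entry at `k`) that are lexicographically smaller than
`γ`. -/
inductive LowerCombo (M : (Fin n → ℕ) → Pt n → ℝ) (k : Fin n) (γ : Fin n → ℕ) :
    (Pt n → ℝ) → Prop
  | of_eq_zero {w : Pt n → ℝ} (h : w =ᶠ[𝓝 0] 0) : LowerCombo M k γ w
  | add_mul {w w' c : Pt n → ℝ} {β : Fin n → ℕ} (hw : LowerCombo M k γ w) (hc : SmoothNear c)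
      (hβ : IsProper k β) (hlt : LexLT β γ) (h : w' =ᶠ[𝓝 0] fun ξ => w ξ + c ξ * M β ξ) :
      LowerCombo M k γ w'

/-- Near the origin, `w` is `u * M γ` with `u(0) ≠ 0` up to a combination of lower terms. -/
def HasLeading (M : (Fin n → ℕ) → Pt n → ℝ) (k : Fin n) (γ : Fin n → ℕ) (w : Pt n → ℝ) : Prop :=
  ∃ u r : Pt n → ℝ, SmoothNear u ∧ u 0 ≠ 0 ∧ LowerCombo M k γ r ∧
    w =ᶠ[𝓝 0] fun ξ => r ξ + u ξ * M γ ξ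

namespace LowerCombo

variable {M : (Fin n → ℕ) → Pt n → ℝ} {k : Fin n} {γ : Fin n → ℕ} {w w' : Pt n → ℝ}

theorem congr (hw : LowerCombo M k γ w) (h : w' =ᶠ[𝓝 0] w) : LowerCombo M k γ w' := by
  cases hw with
  | of_eq_zero h0 => exact of_eq_zero (h.trans h0)
  | add_mul hw hc hβ hlt h' => exact add_mul hw hc hβ hlt (h.trans h')

theorem mul_term {c : Pt n → ℝ} {β : Fin n → ℕ} (hc : SmoothNear c) (hβ : IsProper k β)
    (hlt : LexLT β γ) : LowerCombo M k γ fun ξ => c ξ * M β ξ :=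
  add_mul (of_eq_zero (EventuallyEq.refl _ 0)) hc hβ hlt
    (Eventually.of_forall fun ξ => by simp)

theorem add (hw : LowerCombo M k γ w) (hw' : LowerCombo M k γ w') :
    LowerCombo M k γ fun ξ => w ξ + w' ξ := by
  induction hw' with
  | of_eq_zero h => exact hw.congr (h.mono fun ξ h => by simp [h])
  | add_mul _ hc hβ hlt h ih =>
    exact add_mul ih hc hβ hlt (h.mono fun ξ h => by simp [h, add_assoc])

theorem sum {ι : Type*} {t : Finset ι} {w : ι → Pt n → ℝ} (h : ∀ i ∈ t, LowerCombo M k γ (w i)) :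
    LowerCombo M k γ fun ξ => ∑ i ∈ t, w i ξ := by
  classical
  induction t using Finset.induction_on with
  | empty => exact of_eq_zero (Eventually.of_forall fun ξ => by simp)
  | insert a t ha ih =>
    simp only [Finset.sum_insert ha]
    exact (h a (Finset.mem_insert_self a t)).add (ih fun i hi => h i (Finset.mem_insert_of_mem hi))

theorem mul_left {c : Pt n → ℝ} (hc : SmoothNear c) (hw : LowerCombo M k γ w) :
    LowerCombo M k γ fun ξ => c ξ * w ξ := by
  induction hw with
  | of_eq_zero h => exact of_eq_zero (h.mono fun ξ h => by simp [h])
  | add_mul _ hc' hβ hlt h ih =>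
    exact add_mul ih (hc.mul hc') hβ hlt (h.mono fun ξ h => by simp only [h]; ring)

theorem mono {γ' : Fin n → ℕ} (hw : LowerCombo M k γ w) (hγ : LexLT γ γ') :
    LowerCombo M k γ' w := by
  induction hw with
  | of_eq_zero h => exact of_eq_zero h
  | add_mul _ hc hβ hlt h ih => exact add_mul ih hc hβ (hlt.trans hγ) h

theorem smooth (hM : ∀ β, SmoothNear (M β)) (hw : LowerCombo M k γ w) : SmoothNear w := by
  induction hw with
  | of_eq_zero h => exact (smoothNear_const 0).congr h
  | add_mul _ hc _ _ h ih => exact (ih.add (hc.mul (hM _))).congr h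

theorem apply_zero (hM : ∀ β, IsProper k β → LexLT β γ → M β 0 = 0) (hw : LowerCombo M k γ w) :
    w 0 = 0 := by
  induction hw with
  | of_eq_zero h => exact h.self_of_nhds
  | add_mul _ _ hβ hlt h ih =>
    rw [h.self_of_nhds]
    simp [ih, hM _ hβ hlt]

end LowerCombo

theorem HasLeading.congr {M : (Fin n → ℕ) → Pt n → ℝ} {k : Fin n} {γ : Fin n → ℕ}
    {w w' : Pt n → ℝ} (hw : HasLeading M k γ w) (h : w' =ᶠ[𝓝 0] w) : HasLeading M k γ w' := by
  obtain ⟨u, r, hu, hu0, hr, hw⟩ := hw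
  exact ⟨u, r, hu, hu0, hr, h.trans hw⟩

/-- When the lower terms vanish at the origin, `w` and its leading term vanish together there. -/
theorem HasLeading.apply_zero_iff {M : (Fin n → ℕ) → Pt n → ℝ} {k : Fin n} {γ : Fin n → ℕ}
    {w : Pt n → ℝ} (hw : HasLeading M k γ w) (hM : ∀ β, IsProper k β → LexLT β γ → M β 0 = 0) :
    w 0 = 0 ↔ M γ 0 = 0 := by
  obtain ⟨u, r, hu, hu0, hr, hw⟩ := hw
  rw [hw.self_of_nhds]
  simp [hr.apply_zero hM, hu0]

namespace IsChart

variable {T S : Pt n → Pt n} (hT : IsChart T S) {p : Pt n → ℝ} (hp : SmoothNear p) {k : Fin n}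
  (hk : ∀ s, k < s → pderiv s p =ᶠ[𝓝 0] 0)
include hT hp

theorem smooth_pullDeriv (β : Fin n → ℕ) : SmoothNear (pullDeriv T p β) :=
  (hp.multiDeriv β).comp hT.smooth hT.map_zero

theorem fderiv_pullDeriv (β : Fin n → ℕ) {Y : VF n} :
    (fun ξ => fderiv ℝ (pullDeriv T p β) ξ (Y ξ)) =ᶠ[𝓝 0]
      fun ξ => ∑ s, comp T s Y ξ * pullDeriv T p (β + Pi.single s 1) ξ := by
  have h : ∀ᶠ ξ in 𝓝 0, ∀ s, LowerTri.pderiv s (multiDeriv β p) (T ξ) =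
      pullDeriv T p (β + Pi.single s 1) ξ :=
    eventually_all.2 fun s => hT.tendsto.eventually (pderiv_multiDeriv hp s β)
  filter_upwards [hT.fderiv_comp_eq_sum (hp.multiDeriv β), h] with ξ h1 h2
  refine (h1 (Y ξ)).trans (Finset.sum_congr rfl fun s _ => ?_)
  rw [h2]
  rfl

include hk

theorem pullDeriv_eq_zero (β : Fin n → ℕ) {s : Fin n} (hs : k < s) :
    pullDeriv T p (β + Pi.single s 1) =ᶠ[𝓝 0] 0 :=
  hT.tendsto.eventually (multiDeriv_eq_zero hp (hk s hs) β)

/-- Differentiating `∂^β p` along a field of the `j`-th coordinate distribution gives a multiple of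
`∂^{β + e_j} p` and lower terms: `∂^{β + e_s} p` is lower for `s > j`, and zero for `s > k`. -/
theorem lowerCombo_fderiv_pullDeriv {β : Fin n → ℕ} (hβ : IsProper k β) {j : Fin n} {Y : VF n}
    (hY : SmoothNear Y) (hYD : IsSection Y (coordDistr T j)) :
    LowerCombo (pullDeriv T p) k (β + Pi.single j 1) fun ξ =>
      fderiv ℝ (pullDeriv T p β) ξ (Y ξ) -
        comp T j Y ξ * pullDeriv T p (β + Pi.single j 1) ξ := by
  refine (LowerCombo.sum (t := Finset.univ.erase j)
    (w := fun s ξ => comp T s Y ξ * pullDeriv T p (β + Pi.single s 1) ξ) fun s hs => ?_).congr ?_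
  · rcases (Finset.ne_of_mem_erase hs).lt_or_gt with h | h
    · exact .of_eq_zero ((isSection_coordDistr.1 hYD s h).mono fun ξ h => by simp [h])
    · rcases le_or_gt s k with h' | h'
      · exact .mul_term (hT.smooth.comp_field hY s) (hβ.add_single h') (lexLT_add_single_of_lt β h)
      · exact .of_eq_zero ((hT.pullDeriv_eq_zero hp hk β h').mono fun ξ h => by simp [h])
  · filter_upwards [hT.fderiv_pullDeriv hp β (Y := Y)] with ξ h
    rw [h, ← Finset.add_sum_erase _ _ (Finset.mem_univ j)]
    ring

theorem lowerCombo_fderiv {γ : Fin n → ℕ} {w : Pt n → ℝ} (hw : LowerCombo (pullDeriv T p) k γ w)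
    {j : Fin n} (hj : j ≤ k) {Y : VF n} (hY : SmoothNear Y)
    (hYD : IsSection Y (coordDistr T j)) :
    LowerCombo (pullDeriv T p) k (γ + Pi.single j 1) fun ξ => fderiv ℝ w ξ (Y ξ) := by
  induction hw with
  | of_eq_zero h =>
    exact .of_eq_zero ((fderiv_const_germ h).mono fun ξ h => by simp [h])
  | @add_mul w w' c β hw hc hβ hlt h ih =>
    have hlt' := hlt.add_right (Pi.single j 1)
    have h1 : LowerCombo (pullDeriv T p) k (γ + Pi.single j 1) fun ξ =>
        fderiv ℝ c ξ (Y ξ) * pullDeriv T p β ξ :=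
      .mul_term (hc.fderiv_apply hY) hβ (hlt.trans (lexLT_add_single γ j))
    have h2 := ((hT.lowerCombo_fderiv_pullDeriv hp hk hβ hY hYD).mono hlt').add
      (.mul_term (hT.smooth.comp_field hY j) (hβ.add_single hj) hlt')
    refine (ih.add (h1.add (h2.mul_left hc))).congr ?_
    filter_upwards [h.fderiv (𝕜 := ℝ), (hw.smooth (hT.smooth_pullDeriv hp)).differentiableAt,
      hc.differentiableAt, (hT.smooth_pullDeriv hp β).differentiableAt] with ξ h h3 h4 h5
    rw [h, fderiv_fun_add h3 (h4.fun_mul h5), fderiv_fun_mul h4 h5]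
    simp
    ring

/-- The operator `w ↦ dw(Y) - c w`, with `Y` in the `j`-th coordinate distribution and `Y_j(0) ≠ 0`,
raises the `j`-th entry of the leading multi-index by one. -/
theorem hasLeading_step {γ : Fin n → ℕ} (hγ : IsProper k γ) {w : Pt n → ℝ}
    (hw : HasLeading (pullDeriv T p) k γ w) {j : Fin n} (hj : j ≤ k) {Y : VF n}
    (hY : SmoothNear Y) (hYD : IsSection Y (coordDistr T j)) (hY0 : comp T j Y 0 ≠ 0)
    {c : Pt n → ℝ} (hc : SmoothNear c) :
    HasLeading (pullDeriv T p) k (γ + Pi.single j 1) fun ξ => fderiv ℝ w ξ (Y ξ) - c ξ * w ξ := by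
  obtain ⟨u, r, hu, hu0, hr, hw⟩ := hw
  have hlt := lexLT_add_single γ j
  have hc' : SmoothNear fun ξ => fderiv ℝ u ξ (Y ξ) - c ξ * u ξ :=
    (hu.fderiv_apply hY).sub (hc.mul hu)
  have h1 := (hT.lowerCombo_fderiv hp hk hr hj hY hYD).add
    (((hr.mul_left (c := fun ξ => -1 * c ξ) ((smoothNear_const _).mul hc)).mono hlt).add
    ((LowerCombo.mul_term hc' hγ hlt).add
    ((hT.lowerCombo_fderiv_pullDeriv hp hk hγ hY hYD).mul_left hu)))
  refine ⟨fun ξ => u ξ * comp T j Y ξ, _, hu.mul (hT.smooth.comp_field hY j),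
    mul_ne_zero hu0 hY0, h1, ?_⟩
  filter_upwards [hw, hw.fderiv (𝕜 := ℝ), (hr.smooth (hT.smooth_pullDeriv hp)).differentiableAt,
    hu.differentiableAt, (hT.smooth_pullDeriv hp γ).differentiableAt] with ξ h h' h3 h4 h5
  rw [h', h, fderiv_fun_add h3 (h4.fun_mul h5), fderiv_fun_mul h4 h5]
  simp
  ring

end IsChart

/-! ### Charts that put a system into triangular form -/

variable {m : ℕ}

/-- In the coordinates `x = T(ξ)`, the equations of `ξ' = F(ξ) + G(ξ) u` that are not actuated are
`x_i' = p_i(x)`, they have the triangular structure, and the input acts on the last equation. -/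
structure IsTriangularChart (F G : VF (m + 1)) (T S : Pt (m + 1) → Pt (m + 1))
    (p : Fin m → Pt (m + 1) → ℝ) : Prop extends IsChart T S where
  smooth_drift : SmoothNear F
  smooth_input : SmoothNear G
  smooth_rhs : ∀ i, SmoothNear (p i)
  pderiv_rhs : ∀ i s, i.succ < s → pderiv s (p i) =ᶠ[𝓝 0] 0
  nondegenerate : ∀ i, DenselyNear fun x => pderiv i.succ (p i) x ≠ 0
  comp_drift : ∀ i, comp T i.castSucc F =ᶠ[𝓝 0] fun ξ => p i (T ξ)
  comp_input : ∀ i : Fin m, comp T i.castSucc G =ᶠ[𝓝 0] 0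
  comp_input_last : comp T (Fin.last m) G 0 ≠ 0

namespace IsTriangularChart

variable {F G : VF (m + 1)} {T S : Pt (m + 1) → Pt (m + 1)} {p : Fin m → Pt (m + 1) → ℝ}
  (h : IsTriangularChart F G T S p)
include h

theorem fderiv_comp_drift : ∀ᶠ ξ in 𝓝 (0 : Pt (m + 1)), ∀ i : Fin m,
    ∀ v ∈ coordDistr T (i + 1) ξ, fderiv ℝ (comp T i.castSucc F) ξ v =
      fderiv ℝ T ξ v i.succ * pderiv i.succ (p i) (T ξ) := by
  refine eventually_all.2 fun i => ?_
  have h0 : ∀ᶠ ξ in 𝓝 0, ∀ s, i.succ < s → pderiv s (p i) (T ξ) = 0 :=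
    eventually_all.2 fun s => eventually_imp_distrib_left.2 fun hs =>
      h.tendsto.eventually (h.pderiv_rhs i s hs)
  filter_upwards [(h.comp_drift i).fderiv (𝕜 := ℝ), h.fderiv_comp_eq_sum (h.smooth_rhs i), h0]
    with ξ h1 h2 h3 v hv
  rw [h1, h2]
  refine Finset.sum_eq_single _ (fun s _ hs => ?_) (by simp)
  rcases hs.lt_or_gt with hlt | hlt
  · rw [hv s hlt, zero_mul]
  · rw [h3 s hlt, mul_zero]

/-- Bracketing the drift with a field of a coordinate distribution reaches one equation further. -/
theorem isSection_lieBracket_drift {i : Fin m} {K : VF (m + 1)} (hK : SmoothNear K)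
    (hKD : IsSection K (coordDistr T (i + 1))) :
    IsSection (VectorField.lieBracket ℝ K F) (coordDistr T i) ∧
    comp T i.castSucc (VectorField.lieBracket ℝ K F) =ᶠ[𝓝 0]
      fun ξ => comp T i.succ K ξ * pderiv i.succ (p i) (T ξ) := by
  have key : ∀ t : Fin m, t ≤ i →
      comp T t.castSucc (VectorField.lieBracket ℝ K F) =ᶠ[𝓝 0]
        fun ξ => comp T t.succ K ξ * pderiv t.succ (p t) (T ξ) := by
    intro t ht
    have hK0 : comp T t.castSucc K =ᶠ[𝓝 0] 0 :=
      isSection_coordDistr.1 hKD _ (Nat.lt_succ_of_le ht)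
    filter_upwards [comp_lieBracket h.smooth hK h.smooth_drift t.castSucc, fderiv_const_germ hK0,
      h.fderiv_comp_drift, hKD] with ξ h1 h2 h3 h4
    rw [h1, h2, h3 t _ (coordDistr_anti T ξ (Nat.succ_le_succ ht) h4)]
    simp [comp]
  refine ⟨isSection_coordDistr.2 fun s hs => ?_, key i le_rfl⟩
  obtain ⟨t, rfl⟩ : ∃ t : Fin m, s = t.castSucc :=
    ⟨⟨s, hs.trans i.isLt⟩, rfl⟩
  have ht : (t : ℕ) < i := by simpa using hs
  filter_upwards [key t ht.le, isSection_coordDistr.1 hKD t.succ (by simpa using ht)]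
    with ξ h1 h2
  simp [h1, h2]

/-- The iterated bracket `ad_Y^α F` lies in the `i`-th coordinate distribution, and its `i`-th
component is, up to a factor not vanishing at the origin and lower terms, `∂^α p_i`. The last two
assumptions on `Y j` say that its components before the `i`-th depend on `x_0, …, x_{i-1}` only, and
the `i`-th one on `x_0, …, x_i` only; they make `ad_{Y j}` act on the `i`-th component as a
derivation along `Y j` plus a multiplication. -/
theorem adMulti_hasLeading (i : Fin m) {Y : Fin (m + 1) → VF (m + 1)}
    (hY : ∀ j ≤ i.succ, SmoothNear (Y j))
    (hYD : ∀ j ≤ i.succ, IsSection (Y j) (coordDistr T j))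
    (hY0 : ∀ j ≤ i.succ, comp T j (Y j) 0 ≠ 0)
    (hYi : ∀ j ≤ i.succ, ∀ s < i.castSucc, ∀ᶠ ξ in 𝓝 0, ∀ v ∈ coordDistr T i ξ,
      fderiv ℝ (comp T s (Y j)) ξ v = 0)
    (hYi' : ∀ j ≤ i.succ, ∀ᶠ ξ in 𝓝 0, ∀ v ∈ coordDistr T (i + 1) ξ,
      fderiv ℝ (comp T i.castSucc (Y j)) ξ v = 0)
    {α : Fin (m + 1) → ℕ} (hα : IsProper i.succ α) :
    SmoothNear (adMulti Y α F) ∧ IsSection (adMulti Y α F) (coordDistr T i) ∧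
      HasLeading (pullDeriv T (p i)) i.succ α (comp T i.castSucc (adMulti Y α F)) := by
  refine IsProper.induction (P := fun α => SmoothNear (adMulti Y α F) ∧
    IsSection (adMulti Y α F) (coordDistr T i) ∧
      HasLeading (pullDeriv T (p i)) i.succ α (comp T i.castSucc (adMulti Y α F))) ?_ ?_ hα
  · rw [adMulti, multiIterate_single]
    have hk := hY i.succ le_rfl
    obtain ⟨h1, h2⟩ := h.isSection_lieBracket_drift hk
      (by simpa using hYD i.succ le_rfl)
    refine ⟨hk.lieBracket h.smooth_drift, h1, comp T i.succ (Y i.succ), 0,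
      h.smooth.comp_field hk _, hY0 _ le_rfl, .of_eq_zero (EventuallyEq.refl _ _), ?_⟩
    filter_upwards [h2] with ξ h2
    simp [h2, pullDeriv, multiDeriv, multiIterate_single]
  · intro γ j hγ hj hmin ⟨hW, hWD, hlead⟩
    rw [adMulti, multiIterate_add_single _ hmin]
    change SmoothNear (VectorField.lieBracket ℝ (Y j) (adMulti Y γ F)) ∧
      IsSection (VectorField.lieBracket ℝ (Y j) (adMulti Y γ F)) (coordDistr T i) ∧
      HasLeading _ _ _ (comp T i.castSucc (VectorField.lieBracket ℝ (Y j) (adMulti Y γ F)))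
    set W := adMulti Y γ F
    refine ⟨(hY j hj).lieBracket hW, isSection_coordDistr.2 fun s hs => ?_, ?_⟩
    · filter_upwards [comp_lieBracket h.smooth (hY j hj) hW s,
        fderiv_const_germ (isSection_coordDistr.1 hWD s hs), hYi j hj s hs, hWD] with ξ h1 h2 h3 h4
      simp [h1, h2, h3 _ h4]
    · refine (h.hasLeading_step (h.smooth_rhs i) (h.pderiv_rhs i) hγ hlead hj (hY j hj) (hYD j hj)
        (hY0 j hj) ((h.smooth.comp_field (hY j hj) i.castSucc).fderiv_apply
          (h.smooth_coordField i.castSucc))).congr ?_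
      filter_upwards [comp_lieBracket h.smooth (hY j hj) hW i.castSucc, hYi' j hj, hWD,
        h.fderiv_coordField] with ξ h1 h2 h3 h4
      -- `W - W_i ∂_i` lies in the next distribution, which `d(Y_j)_i` annihilates.
      have h5 := h2 (W ξ - comp T i.castSucc W ξ • coordField T S i.castSucc ξ) fun s hs => by
        rcases Nat.lt_succ_iff_lt_or_eq.1 hs with hs | hs
        · have : s ≠ i.castSucc := fun h => by simp [h] at hs
          simp [h4, h3 s hs, this]
        · have : s = i.castSucc := Fin.ext hs
          simp [h4, this, comp]
      rw [map_sub, map_smul, sub_eq_zero, smul_eq_mul] at h5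
      rw [h1, h5]
      ring

end IsTriangularChart

/-! ### The flag of a triangular system -/

theorem comp_ne_zero {n : ℕ} {T : Pt n → Pt n} {l : Fin n} {W : VF n} {ξ : Pt n}
    (h : W ξ ∈ coordDistr T l ξ) (h' : W ξ ∉ coordDistr T (l + 1) ξ) : comp T l W ξ ≠ 0 := by
  refine fun h0 => h' fun s hs => ?_
  rcases Nat.lt_succ_iff_lt_or_eq.1 hs with hs | hs
  · exact h s hs
  · rw [Fin.ext hs]
    exact h0

namespace IsChart

variable {n : ℕ} {T S : Pt n → Pt n} (hT : IsChart T S)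
include hT

theorem coordField_zero_notMem (l : Fin n) : coordField T S l 0 ∉ coordDistr T (l + 1) 0 :=
  fun h => by
    have := h l (Nat.lt_succ_self _)
    rw [hT.fderiv_coordField.self_of_nhds l] at this
    simp at this

theorem coordDistr_eq_bot : ∀ᶠ ξ in 𝓝 (0 : Pt n), coordDistr T n ξ = ⊥ := by
  filter_upwards [hT.fderiv_injective] with ξ h
  refine (Submodule.eq_bot_iff _).2 fun v hv => h ?_
  rw [_root_.map_zero]
  funext s
  exact hv s s.isLt

/-- Fields `X l` of the coordinate distributions whose leading components do not vanish at the
origin span these distributions. -/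
theorem coordDistr_le_span {X : Fin n → VF n} (hX : ∀ l, SmoothNear (X l))
    (hXD : ∀ l, IsSection (X l) (coordDistr T l)) (hX0 : ∀ l, comp T l (X l) 0 ≠ 0) :
    ∀ᶠ ξ in 𝓝 (0 : Pt n), ∀ r, coordDistr T r ξ ≤
      Submodule.span ℝ {x | ∃ l : Fin n, r ≤ (l : ℕ) ∧ x = X l ξ} := by
  filter_upwards [hT.fderiv_injective, eventually_all.2 hXD, eventually_all.2 fun l =>
    (hT.smooth.comp_field (hX l) l).continuousAt.eventually_ne (hX0 l)] with ξ h1 h2 h3 r v hv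
  exact mem_span_of_echelon (L := (fderiv ℝ T ξ : Pt n →ₗ[ℝ] Pt n)) (w := fun l => X l ξ) h1
    (fun l s hs => h2 l s hs) h3 hv

end IsChart

namespace IsTriangularChart

variable {F G : VF (m + 1)} {T S : Pt (m + 1) → Pt (m + 1)} {p : Fin m → Pt (m + 1) → ℝ}
  (h : IsTriangularChart F G T S p)
include h

theorem isSection_input : IsSection G (coordDistr T m) :=
  isSection_coordDistr.2 fun s hs => h.comp_input ⟨s, hs⟩

theorem comp_input_last_ne_zero : ∀ᶠ ξ in 𝓝 0, comp T (Fin.last m) G ξ ≠ 0 :=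
  (h.smooth.comp_field h.smooth_input _).continuousAt.eventually_ne h.comp_input_last

theorem coordDistr_eq_span_input :
    ∀ᶠ ξ in 𝓝 0, coordDistr T m ξ = Submodule.span ℝ {G ξ} := by
  filter_upwards [h.isSection_input, h.comp_input_last_ne_zero, h.finrank_coordDistr m]
    with ξ h1 h2 h3
  refine (Submodule.eq_of_le_of_finrank_eq ?_ ?_).symm
  · rwa [Submodule.span_singleton_le_iff_mem]
  · rw [h3, finrank_span_singleton fun h0 => h2 (by simp [comp, h0])]
    omega

/-- Whatever the choice of the fields `K i` in the coordinate distributions, the brackets stay in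
these distributions. -/
theorem hatDistr_le {K : Fin m → VF (m + 1)} {l : Fin m} (hK : ∀ i, SmoothNear (K i))
    (hKD : ∀ i, l ≤ i → IsSection (K i) (coordDistr T (i + 1))) :
    ∀ᶠ ξ in 𝓝 0, hatDistr F G K l ξ ≤ coordDistr T l ξ := by
  have hbr : ∀ᶠ ξ in 𝓝 0, ∀ i, l ≤ i →
      VectorField.lieBracket ℝ (K i) F ξ ∈ coordDistr T i ξ :=
    eventually_all.2 fun i => eventually_imp_distrib_left.2 fun hi =>
      (h.isSection_lieBracket_drift (hK i) (hKD i hi)).1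
  filter_upwards [h.isSection_input, hbr] with ξ h1 h2
  rw [hatDistr, Submodule.span_le]
  rintro v (rfl | ⟨i, hi, rfl⟩)
  · exact coordDistr_anti T ξ l.isLt.le h1
  · exact coordDistr_anti T ξ hi (h2 i hi)

theorem isSystemFlag_coordDistr : IsSystemFlag F G (coordDistr T) where
  top := h.coordDistr_eq_bot
  input := h.coordDistr_eq_span_input
  smooth l _ := h.isSmoothDistr_coordDistr l
  involutive l _ := h.isInvolutive_coordDistr l
  generated := by
    have hK := fun i : Fin m => h.smooth_coordField i.succ
    have hKD : ∀ i : Fin m, IsSection (coordField T S i.succ) (coordDistr T (i + 1)) := fun i => by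
      simpa using h.isSection_coordField i.succ
    refine ⟨fun i => coordField T S i.succ, fun i => ⟨hK i, hKD i, fun hsec =>
      h.coordField_zero_notMem i.succ (by simpa using hsec.self_of_nhds), ?_⟩⟩
    have hdense := denselyNear_all fun i => h.denselyNear_comp (h.nondegenerate i)
    have hle : ∀ᶠ ξ in 𝓝 0, hatDistr F G (fun i => coordField T S i.succ) i ξ ≤
      coordDistr T i ξ := h.hatDistr_le hK fun i _ => hKD i
    refine (hdense.and (denselyNear_of_eventually (hle.and
      (h.fderiv_injective.and (h.isSection_input.and (h.comp_input_last_ne_zero.and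
      ((eventually_all.2 fun i => (h.isSection_lieBracket_drift (hK i) (hKD i)).1).and
      ((eventually_all.2 fun i => (h.isSection_lieBracket_drift (hK i) (hKD i)).2).and
      h.fderiv_coordField)))))))).mono fun ξ hξ => ?_
    obtain ⟨h1, h2, h3, h4, h5, h6, h7, h8⟩ := hξ
    refine le_antisymm (fun v hv => ?_) h2
    refine Submodule.span_mono ?_ (mem_span_of_echelon
      (L := (fderiv ℝ T ξ : Pt (m + 1) →ₗ[ℝ] Pt (m + 1)))
      (w := Fin.lastCases (G ξ) fun i => VectorField.lieBracket ℝ (coordField T S i.succ) F ξ)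
      h3 ?_ ?_ hv)
    · rintro _ ⟨j, hj, rfl⟩
      induction j using Fin.lastCases with
      | last => simp
      | cast j => exact Or.inr ⟨j, by simpa using hj, by simp⟩
    · intro l s hs
      induction l using Fin.lastCases with
      | last => simpa using h4 s hs
      | cast l => simpa using h6 l s hs
    · intro l
      induction l using Fin.lastCases with
      | last => simpa [comp] using h5
      | cast l =>
        have := h7 l
        simp only [comp, h8, Pi.single_eq_same, one_mul] at this
        simpa [this] using h1 l

/-- The coordinate distributions are the only flag of the system: downwards in `l`, the brackets
defining `D l` lie in the `l`-th coordinate distribution; by density and continuity so does `D l`,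
and the dimensions agree. -/
theorem eq_coordDistr {D : ℕ → Distr (m + 1)} (hD : IsSystemFlag F G D) :
    ∀ l ≤ m + 1, D l =ᶠ[𝓝 0] coordDistr T l := by
  intro l hl
  induction hd : m + 1 - l using Nat.strong_induction_on generalizing l with
  | _ d ih =>
    rcases Nat.lt_trichotomy l m with hlm | rfl | hlm
    · obtain ⟨K, hK⟩ := hD.generated
      obtain ⟨V, hV, hVD⟩ := hD.smooth l hl
      have hKD : ∀ i, (⟨l, hlm⟩ : Fin m) ≤ i → IsSection (K i) (coordDistr T (i + 1)) := by
        intro i hi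
        have hi' : l ≤ i := hi
        filter_upwards [ih _ (by omega) (i + 1) (by omega) rfl, (hK i).2.1] with ξ h1 h2
        rwa [← h1]
      have hVs : ∀ᶠ ξ in 𝓝 0, ∀ (k) (s : Fin (m + 1)), (s : ℕ) < l → comp T s (V k) ξ = 0 := by
        have hc : ∀ᶠ ξ in 𝓝 0, ∀ k s, ContinuousAt (comp T s (V k)) ξ :=
          eventually_all.2 fun k => eventually_all.2 fun s =>
            (h.smooth.comp_field (hV k) s).mono fun _ h => h.continuousAt
        filter_upwards [(hK ⟨l, hlm⟩).2.2.2.frequently, hc, hVD.eventually_nhds,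
          (h.hatDistr_le (fun i => (hK i).1) hKD).eventually_nhds] with ξ h1 h2 h3 h4 k s hs
        by_contra hne
        obtain ⟨η, h5, h6, h7, h8⟩ :=
          (h1.and_eventually (h3.and (h4.and ((h2 k s).eventually_ne hne)))).exists
        refine h8 (h7 ?_ s hs)
        change D l η = hatDistr F G K l η at h5
        rw [← h5, h6.2]
        exact Submodule.subset_span ⟨k, rfl⟩
      filter_upwards [hVs, hVD, h.finrank_coordDistr l] with ξ h1 h2 h3
      refine Submodule.eq_of_le_of_finrank_eq ?_ ?_
      · rw [h2.2, Submodule.span_le]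
        rintro _ ⟨k, rfl⟩ s hs
        exact h1 k s hs
      · rw [h3, h2.2, finrank_span_eq_card h2.1, Fintype.card_fin]
    · filter_upwards [hD.input, h.coordDistr_eq_span_input] with ξ h1 h2
      rw [h1, h2]
    · obtain rfl : l = m + 1 := by omega
      filter_upwards [hD.top, h.coordDistr_eq_bot] with ξ h1 h2
      rw [h1, h2]

/-! ### The bracket test -/

theorem isAdaptedData_coordField :
    IsAdaptedData F G (coordDistr T) (coordField T S) fun _ => coordField T S :=
  ⟨h.isSystemFlag_coordDistr,
    fun l => ⟨h.smooth_coordField l, h.isSection_coordField l, h.coordField_zero_notMem l⟩,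
    fun _ j _ => ⟨h.smooth_coordField j, h.isSection_coordField j, h.coordField_zero_notMem j,
      fun l _ => h.lieBracket_coordField l j _, h.lieBracket_coordField _ j _⟩⟩

/-- A field `Y` whose brackets with the fields `X l`, `r ≤ l`, of a frame lie in the `r`-th
coordinate distribution has components before the `r`-th that depend on `x_0, …, x_{r-1}` only. -/
theorem fderiv_comp_eq_zero {X : Fin (m + 1) → VF (m + 1)} (hX : ∀ l, SmoothNear (X l))
    (hXD : ∀ l, IsSection (X l) (coordDistr T l)) (hX0 : ∀ l, comp T l (X l) 0 ≠ 0)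
    {Y : VF (m + 1)} (hY : SmoothNear Y) {r : ℕ}
    (hbr : ∀ l : Fin (m + 1), r ≤ (l : ℕ) →
      ∀ s : Fin (m + 1), (s : ℕ) < r → comp T s (VectorField.lieBracket ℝ (X l) Y) =ᶠ[𝓝 0] 0)
    {s : Fin (m + 1)} (hs : (s : ℕ) < r) :
    ∀ᶠ ξ in 𝓝 0, ∀ v ∈ coordDistr T r ξ, fderiv ℝ (comp T s Y) ξ v = 0 := by
  have h1 : ∀ᶠ ξ in 𝓝 0, ∀ l : Fin (m + 1), r ≤ (l : ℕ) →
      fderiv ℝ (comp T s Y) ξ (X l ξ) = 0 := by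
    refine eventually_all.2 fun l => eventually_imp_distrib_left.2 fun hl => ?_
    filter_upwards [hbr l hl s hs, comp_lieBracket h.smooth (hX l) hY s,
      fderiv_const_germ (isSection_coordDistr.1 (hXD l) s (hs.trans_le hl))] with ξ h1 h2 h3
    simpa [h1, h3] using h2.symm
  filter_upwards [h1, h.coordDistr_le_span hX hXD hX0] with ξ h1 h2 v hv
  refine (Submodule.span_le (p := LinearMap.ker (fderiv ℝ (comp T s Y) ξ : Pt (m + 1) →ₗ[ℝ] ℝ))).2
    ?_ (h2 r hv)
  rintro _ ⟨l, hl, rfl⟩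
  exact h1 l hl

/-- Whatever the adapted data, the bracket test for `α` says that `α i` is the lexicographically
least multi-index of the `i`-th right-hand side. -/
theorem bracketTest_iff {D : ℕ → Distr (m + 1)} {X : Fin (m + 1) → VF (m + 1)}
    {Y : Fin m → Fin (m + 1) → VF (m + 1)} (hdata : IsAdaptedData F G D X Y)
    {α : Fin m → Fin (m + 1) → ℕ} (hα : ∀ i : Fin m, IsProper i.succ (α i)) :
    BracketTest F D Y α ↔ ∀ i : Fin m, IsLeastIndex i.succ (p i) (α i) := by
  obtain ⟨hD, hX, hY⟩ := hdata
  have hDE := h.eq_coordDistr hD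
  have hsec : ∀ {W : VF (m + 1)} {l : ℕ}, l ≤ m + 1 → IsSection W (D l) →
      IsSection W (coordDistr T l) := fun {W l} hl hW => by
    filter_upwards [hW, hDE l hl] with ξ h1 h2
    rwa [← h2]
  have hXs := fun l => (hX l).1
  have hXD := fun l => hsec l.isLt.le (hX l).2.1
  have hX0 : ∀ l, comp T l (X l) 0 ≠ 0 := fun l =>
    comp_ne_zero (hXD l).self_of_nhds fun h0 => (hX l).2.2 (by
      rwa [(hDE (l + 1) l.isLt).self_of_nhds])
  have hlead : ∀ (i : Fin m) (β : Fin (m + 1) → ℕ), IsProper i.succ β →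
      HasLeading (pullDeriv T (p i)) i.succ β (comp T i.castSucc (adMulti (Y i) β F)) ∧
      (adMulti (Y i) β F 0 ∈ D (i + 1) 0 ↔ comp T i.castSucc (adMulti (Y i) β F) 0 = 0) := by
    intro i β hβ
    have hbr : ∀ j ≤ i.succ, ∀ l : Fin (m + 1), (i : ℕ) + 1 ≤ l → ∀ s : Fin (m + 1),
        (s : ℕ) < i + 1 → comp T s (VectorField.lieBracket ℝ (X l) (Y i j)) =ᶠ[𝓝 0] 0 :=
      fun j hj l hl => isSection_coordDistr.1
        (hsec (by omega) ((hY i j hj).2.2.2.1 l hl))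
    obtain ⟨-, h2, h3⟩ := h.adMulti_hasLeading i (Y := Y i) (fun j hj => (hY i j hj).1)
      (fun j hj => hsec j.isLt.le (hY i j hj).2.1)
      (fun j hj => comp_ne_zero (hsec j.isLt.le (hY i j hj).2.1).self_of_nhds fun h0 =>
        (hY i j hj).2.2.1 (by rwa [(hDE (j + 1) j.isLt).self_of_nhds]))
      (fun j hj s hs => h.fderiv_comp_eq_zero hXs hXD hX0 (hY i j hj).1 (fun l hl s hs => by
        rcases hl.eq_or_lt with hl | hl
        · obtain rfl : l = i.castSucc := Fin.ext hl.symm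
          exact isSection_coordDistr.1 (hsec (by omega) (hY i j hj).2.2.2.2) s hs
        · exact hbr j hj l hl s (by omega)) hs)
      (fun j hj => h.fderiv_comp_eq_zero hXs hXD hX0 (hY i j hj).1 (hbr j hj)
        (Nat.lt_succ_self _)) hβ
    refine ⟨h3, ?_⟩
    rw [(hDE (i + 1) (by omega)).self_of_nhds]
    refine ⟨fun h0 => h0 i.castSucc (Nat.lt_succ_self _), fun h0 => ?_⟩
    by_contra hne
    exact comp_ne_zero (l := i.castSucc) h2.self_of_nhds hne h0
  have hM : ∀ i β, pullDeriv T (p i) β 0 = multiDeriv β (p i) 0 := fun i β => by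
    rw [pullDeriv, h.map_zero]
  refine forall_congr' fun i => ⟨fun ⟨h1, h2⟩ => ?_, fun ⟨h1, h2⟩ => ?_⟩
  · have hzero : ∀ β, IsProper i.succ β → LexLT β (α i) → pullDeriv T (p i) β 0 = 0 := by
      intro β
      induction β using lexLT_wellFounded.induction with
      | _ β ih =>
        intro hβ hlt
        obtain ⟨h3, h4⟩ := hlead i β hβ
        exact (h3.apply_zero_iff fun δ hδ hδβ => ih δ hδβ hδ (hδβ.trans hlt)).1
          (h4.1 (h2 β hβ hlt))
    obtain ⟨h3, h4⟩ := hlead i _ (hα i)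
    refine ⟨⟨hα i, fun h0 => h1 (h4.2 ((h3.apply_zero_iff hzero).2 ((hM _ _).trans h0)))⟩,
      fun β hβ hne => ?_⟩
    rcases lt_trichotomy (toLex (α i)) (toLex β) with hlt | heq | hgt
    · exact lexLT_iff.2 hlt
    · exact absurd (toLex.injective heq).symm hne
    · exact absurd ((hM i β).symm.trans (hzero β hβ.1 (lexLT_iff.2 hgt))) hβ.2
  · have hzero : ∀ β, IsProper i.succ β → LexLT β (α i) → pullDeriv T (p i) β 0 = 0 := by
      intro β hβ hlt
      by_contra hne
      have hlt' := lexLT_iff.1 hlt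
      exact lt_asymm hlt' (lexLT_iff.1 (h2 β ⟨hβ, fun h0 => hne ((hM i β).trans h0)⟩
        fun h0 => hlt'.ne (congrArg toLex h0)))
    constructor
    · obtain ⟨h3, h4⟩ := hlead i _ (hα i)
      exact fun h0 => h1.2 ((hM _ _).symm.trans ((h3.apply_zero_iff hzero).1 (h4.1 h0)))
    · intro β hβ hlt
      obtain ⟨h3, h4⟩ := hlead i β hβ
      exact h4.2 ((h3.apply_zero_iff fun δ hδ hδβ => hzero δ hδ (hδβ.trans hlt)).2
        (hzero β hβ hlt))

end IsTriangularChart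

/-! ### Feedback equivalence -/

theorem FeedbackEquivalent.exists_isTriangularChart {F G f g : VF (m + 1)} (hF : SmoothNear F)
    (hG : SmoothNear G) (he : FeedbackEquivalent F G f g) (hfg : IsLowerTriangular f g) :
    ∃ T S, IsTriangularChart F G T S fun i x => f x i.castSucc := by
  obtain ⟨T, a, b, ⟨hT0, hT, S, hS, hST, hTS⟩, -, hb, hb0, hfb⟩ := he
  have hchart : IsChart T S := ⟨hT0, hT, hS, hST, hTS⟩
  have hbG : ∀ s, ∀ᶠ ξ in 𝓝 0, b ξ * comp T s G ξ = g (T ξ) s := fun s => by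
    filter_upwards [hfb] with ξ h
    rw [← h.2]
    simp [comp]
  have hGi : ∀ i : Fin m, comp T i.castSucc G =ᶠ[𝓝 0] 0 := fun i => by
    filter_upwards [hbG i.castSucc, hchart.tendsto.eventually hfg.g_eq_zero,
      hb.continuousAt.eventually_ne hb0] with ξ h1 h2 h3
    rw [h2] at h1
    exact (mul_eq_zero.1 h1).resolve_left h3
  refine ⟨T, S, { hchart with
    smooth_drift := hF
    smooth_input := hG
    smooth_rhs := fun i => hfg.smooth_f.coord _
    pderiv_rhs := fun i s hs => ?_
    nondegenerate := hfg.nondegenerate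
    comp_drift := fun i => ?_
    comp_input := hGi
    comp_input_last := fun h0 => ?_ }⟩
  · obtain ⟨U, hU, hUf⟩ := hfg.depends i
    filter_upwards [eventually_mem_nhds_iff.2 hU,
      (hfg.smooth_f.coord i.castSucc).differentiableAt] with x hx hd
    -- The restriction to the line through `x` in direction `e_s` is constant near `x`.
    have hline : HasDerivAt (fun t : ℝ => x + t • (Pi.single s 1 : Pt (m + 1)))
        (Pi.single s 1) 0 := by
      simpa using ((hasDerivAt_id (0 : ℝ)).smul_const (Pi.single s 1 : Pt (m + 1))).const_add x
    have h1 : HasDerivAt (fun t : ℝ => f (x + t • (Pi.single s 1 : Pt (m + 1))) i.castSucc)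
        (fderiv ℝ (fun z => f z i.castSucc) x (Pi.single s 1)) 0 := by
      refine HasFDerivAt.comp_hasDerivAt (f := fun t : ℝ => x + t • (Pi.single s 1 : Pt (m + 1)))
        (l := fun z => f z i.castSucc) 0 ?_ hline
      simpa using hd.hasFDerivAt
    have h2 : (fun t : ℝ => f (x + t • (Pi.single s 1 : Pt (m + 1))) i.castSucc) =ᶠ[𝓝 0]
        fun _ => f x i.castSucc := by
      have hc := hline.continuousAt.tendsto
      rw [zero_smul, add_zero] at hc
      filter_upwards [hc hx] with t ht
      refine hUf _ ht _ (mem_of_mem_nhds hx) fun k hk => ?_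
      have : k ≠ s := fun h => by rw [h] at hk; exact absurd hs (not_lt.2 hk)
      simp [this]
    exact h1.unique ((hasDerivAt_const (0 : ℝ) _).congr_of_eventuallyEq h2)
  · filter_upwards [hfb, hGi i] with ξ h1 h2
    have h3 : fderiv ℝ T ξ (G ξ) i.castSucc = 0 := h2
    rw [← h1.1]
    simp [comp, h3]
  · have := (hbG (Fin.last m)).self_of_nhds
    rw [h0, mul_zero, hT0] at this
    exact hfg.g_last this.symm

end LowerTri

theorem mainTheorem8 (m : ℕ) (F G : LowerTri.VF (m + 1))
    (hF : LowerTri.SmoothNear F) (hG : LowerTri.SmoothNear G)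
    (hF0 : F 0 = 0) (hG0 : ∃ j, G 0 j ≠ 0)
    (α : Fin m → Fin (m + 1) → ℕ) (hα : ∀ i : Fin m, LowerTri.IsProper i.succ (α i)) :
    (LowerTri.EquivTriangularOfType F G α ↔
      LowerTri.EquivTriangular F G ∧
        ∀ D X Y, LowerTri.IsAdaptedData F G D X Y → LowerTri.BracketTest F D Y α) ∧
    (LowerTri.EquivTriangularOfType F G α ↔
      LowerTri.EquivTriangular F G ∧
        ∃ D X Y, LowerTri.IsAdaptedData F G D X Y ∧ LowerTri.BracketTest F D Y α) := by
  refine ⟨⟨?_, ?_⟩, ⟨?_, ?_⟩⟩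
  · rintro ⟨f, g, he, hfg, hleast⟩
    obtain ⟨T, S, h⟩ := he.exists_isTriangularChart hF hG hfg
    exact ⟨⟨f, g, he, hfg⟩, fun D X Y hdata => (h.bracketTest_iff hdata hα).2 hleast⟩
  · rintro ⟨⟨f, g, he, hfg⟩, htest⟩
    obtain ⟨T, S, h⟩ := he.exists_isTriangularChart hF hG hfg
    have hdata := h.isAdaptedData_coordField
    exact ⟨f, g, he, hfg, (h.bracketTest_iff hdata hα).1 (htest _ _ _ hdata)⟩
  · rintro ⟨f, g, he, hfg, hleast⟩
    obtain ⟨T, S, h⟩ := he.exists_isTriangularChart hF hG hfg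
    have hdata := h.isAdaptedData_coordField
    exact ⟨⟨f, g, he, hfg⟩, _, _, _, hdata, (h.bracketTest_iff hdata hα).2 hleast⟩
  · rintro ⟨⟨f, g, he, hfg⟩, D, X, Y, hdata, htest⟩
    obtain ⟨T, S, h⟩ := he.exists_isTriangularChart hF hG hfg
    exact ⟨f, g, he, hfg, (h.bracketTest_iff hdata hα).1 htest⟩
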